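/- Let $n\ge 0$, $m\ge 1$, $r\ge 0$ and let $G(\lambda)\in\mathbb{C}(\lambda)^{n\times n}$ have a minimal realization $$G(\lambda)=P(\lambda)+C(\lambda E-A)^{-1}B,\qquad P(\lambda)=\sum_{j=0}^{m}\lambda^jA_j,\quad A_m\neq 0,$$ with $A_j\in\mathbb{C}^{n\times n}$, $C\in\mathbb{C}^{n\times r}$, $B\in\mathbb{C}^{r\times n}$, $A,E\in\mathbb{C}^{r\times r}$ and $E$ nonsingular (minimal: $r$ is the smallest size of the pencil $\lambda E'-A'$ among all realizations of $G(\lambda)$ as a matrix polynomial plus $C'(\lambda E'-A')^{-1}B'$ with $E'$ nonsingular). Let $$\mathcal{S}(\lambda)=\begin{bmatrix}P(\lambda)&C\\ B&A-\lambda E\end{bmatrix}$$ be its system matrix; a system matrix is called irreducible if the corresponding realization is minimal. Define the $(mn+r)\times(mn+r)$ Fiedler matrices $$\mathbb{M}_0=\begin{bmatrix}\mathrm{diag}(I_{(m-1)n},-A_0)&-e_m\otimes C\\ -e_m^T\otimes B&-A\end{bmatrix},\qquad \mathbb{M}_{-m}=\mathrm{diag}(A_m,\,I_{(m-1)n},\,-E),$$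 $$\mathbb{M}_i=\mathrm{diag}\!\left(I_{(m-i-1)n},\begin{bmatrix}-A_i&I_n\\ I_n&0\end{bmatrix},I_{(i-1)n},\,I_r\right),\qquad \mathbb{M}_{-i}=\mathbb{M}_i^{-1}\qquad(1\le i\le m-1),$$ and, when $A_m$ is nonsingular, $\mathbb{M}_m=\mathbb{M}_{-m}^{-1}$. For a tuple $t=(t_1,\dots,t_k)$ put $\mathbb{M}_t=\mathbb{M}_{t_1}\cdots\mathbb{M}_{t_k}$ (the identity if $t$ is empty) and $-t=(-t_1,\dots,-t_k)$. Let $\omega=(\omega_0,\omega_1)$ be a permutation of $\{0,1,\dots,m\}$ with $0\in\omega_0$; if $m\in\omega_0$, assume that $A_m$ is nonsingular, so that $\mathbb{M}_{\omega_0}$ is defined. Then the generalized Fiedler pencil $$\mathbb{T}_\omega(\lambda)=\lambda\,\mathbb{M}_{-\omega_1}-\mathbb{M}_{\omega_0}$$ is a Rosenbrock strong linearization of $G(\lambda)$. That is, $\mathbb{T}_\omega(\lambda)$ is an irreducible system matrix of the form $$\mathbb{T}_\omega(\lambda)=\begin{bmatrix}\mathcal{X}-\lambda\mathcal{Y}&\mathcal{C}\\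 \mathcal{B}&H-\lambda K\end{bmatrix}$$ with constant blocks $\mathcal{X},\mathcal{Y}\in\mathbb{C}^{mn\times mn}$, $\mathcal{C}\in\mathbb{C}^{mn\times r}$, $\mathcal{B}\in\mathbb{C}^{r\times mn}$, $H,K\in\mathbb{C}^{r\times r}$ and $K$ nonsingular, and: (a) there are $mn\times mn$ unimodular matrix polynomials $U(\lambda),V(\lambda)$ and nonsingular $U_0,V_0\in\mathbb{C}^{r\times r}$ such that $$\mathrm{diag}(U(\lambda),U_0)\,\mathbb{T}_\omega(\lambda)\,\mathrm{diag}(V(\lambda),V_0)=\mathrm{diag}(I_{(m-1)n},\mathcal{S}(\lambda));$$ (b) there are $mn\times mn$ biproper rational matrices $\mathcal{O}_\ell(\lambda),\mathcal{O}_r(\lambda)$ (rational matrices with a nonsingular limit as $\lambda\to\infty$) such that $$\mathcal{O}_\ell(\lambda)\,\lambda^{-1}\mathbb{G}(\lambda)\,\mathcal{O}_r(\lambda)=\mathrm{diag}(I_{(m-1)n},\lambda^{-m}G(\lambda)),$$ where $\mathbb{G}(\lambda)=\mathcal{X}-\lambda\mathcal{Y}+\mathcal{C}(\lambda K-H)^{-1}\mathcal{B}$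 is the transfer function of $\mathbb{T}_\omega(\lambda)$. -/

import Mathlib

namespace RatMat

open Polynomial

/-! ### Realizations, system matrices, transfer functions -/

/-- A realization `P(λ) + C (λ E - A)⁻¹ B`, with `P` a matrix polynomial, `λ E - A` an
`r × r` pencil and `E` nonsingular. -/
structure Realization (ι : Type*) (r : ℕ) where
  P : Matrix ι ι ℂ[X]
  C : Matrix ι (Fin r) ℂ
  E : Matrix (Fin r) (Fin r) ℂ
  A : Matrix (Fin r) (Fin r) ℂ
  B : Matrix (Fin r) ι ℂ
  nonsingular : IsUnit E.det

namespace Realization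

variable {ι : Type*} {r : ℕ}

/-- The coefficient `A_j` of `λ ^ j` in `P(λ)`. -/
noncomputable def coeff (S : Realization ι r) (j : ℕ) : Matrix ι ι ℂ :=
  S.P.map fun p => p.coeff j

/-- The rational matrix `P(λ) + C (λ E - A)⁻¹ B`.  Since `E` is nonsingular, the matrix
`λ E - A` is invertible over `ℂ(λ)`. -/
noncomputable def transferFunction (S : Realization ι r) : Matrix ι ι (RatFunc ℂ) :=
  S.P.map (algebraMap ℂ[X] (RatFunc ℂ)) +
    S.C.map RatFunc.C * ((RatFunc.X : RatFunc ℂ) • S.E.map RatFunc.C - S.A.map RatFunc.C)⁻¹ *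
      S.B.map RatFunc.C

/-- The system matrix `[P(λ), C; B, A - λ E]`. -/
noncomputable def systemMatrix (S : Realization ι r) : Matrix (ι ⊕ Fin r) (ι ⊕ Fin r) ℂ[X] :=
  Matrix.fromBlocks S.P (S.C.map Polynomial.C) (S.B.map Polynomial.C)
    (S.A.map Polynomial.C - (X : ℂ[X]) • S.E.map Polynomial.C)

/-- The realization is minimal: the size `r` of the pencil `λ E - A` is the smallest among all
realizations of the same rational matrix.  The system matrix is called irreducible if the
realization is minimal. -/
def IsMinimal (S : Realization ι r) : Prop :=
  ∀ (r' : ℕ) (S' : Realization ι r'), S'.transferFunction = S.transferFunction → r ≤ r'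

end Realization

/-! ### Block matrices

The index set `Fin m × ι` stands for `m` blocks of size `ι`; the last block (number `m`) is the
one whose `0`-based index `i` satisfies `i + 1 = m`. -/

section Blocks

variable {ι κ R : Type*}

/-- `diag(I, …, I, Z)`, with `m` diagonal blocks. -/
def lastDiag (m : ℕ) [DecidableEq ι] [Zero R] [One R] (Z : Matrix ι ι R) :
    Matrix (Fin m × ι) (Fin m × ι) R :=
  Matrix.of fun i j =>
    (if i.1 = j.1 then if (i.1 : ℕ) + 1 = m then Z else 1 else 0 : Matrix ι ι R) i.2 j.2

/-- `e_m ⊗ Z`. -/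
def lastCol (m : ℕ) [Zero R] (Z : Matrix ι κ R) : Matrix (Fin m × ι) κ R :=
  Matrix.of fun i k => if (i.1 : ℕ) + 1 = m then Z i.2 k else 0

/-- `e_mᵀ ⊗ Z`. -/
def lastRow (m : ℕ) [Zero R] (Z : Matrix κ ι R) : Matrix κ (Fin m × ι) R :=
  Matrix.of fun k j => if (j.1 : ℕ) + 1 = m then Z k j.2 else 0

/-- `diag(I, …, I, Z)`, with `m - 1` identity blocks of size `ι`, for a matrix `Z` that is itself
partitioned into `2 × 2` blocks. -/
def padIdentity (m : ℕ) [DecidableEq ι] [Zero R] [One R] (Z : Matrix (ι ⊕ κ) (ι ⊕ κ) R) :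
    Matrix ((Fin m × ι) ⊕ κ) ((Fin m × ι) ⊕ κ) R :=
  Matrix.fromBlocks (lastDiag m Z.toBlocks₁₁) (lastCol m Z.toBlocks₁₂)
    (lastRow m Z.toBlocks₂₁) Z.toBlocks₂₂

end Blocks

/-! ### Rosenbrock strong linearizations -/

/-- A matrix polynomial is unimodular if its determinant is a nonzero constant. -/
def IsUnimodular {ι : Type*} [Fintype ι] [DecidableEq ι] (U : Matrix ι ι ℂ[X]) : Prop :=
  ∃ c : ℂ, c ≠ 0 ∧ U.det = Polynomial.C c

/-- A rational matrix `F(λ)` is biproper if `F(λ)` tends to a nonsingular matrix as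
`λ → ∞`. -/
def IsBiproper {ι : Type*} [Fintype ι] [DecidableEq ι] (F : Matrix ι ι (RatFunc ℂ)) : Prop :=
  ∃ D : Matrix ι ι ℂ, IsUnit D.det ∧
    Filter.Tendsto (fun z : ℂ => F.map fun f => f.eval (RingHom.id ℂ) z)
      (Bornology.cobounded ℂ) (nhds D)

/-- `L(λ)` is a Rosenbrock strong linearization of the rational matrix `G(λ)`, whose system
matrix is that of the realization `S`: `L(λ) = [𝒳 - λ 𝒴, 𝒞; ℬ, H - λ K]` is an irreducible system
matrix with `K` nonsingular, such that (a) and (b) below hold. -/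
def IsRosenbrockStrongLinearization {n r : ℕ} (m : ℕ) (G : Matrix (Fin n) (Fin n) (RatFunc ℂ))
    (S : Realization (Fin n) r)
    (L : Matrix ((Fin m × Fin n) ⊕ Fin r) ((Fin m × Fin n) ⊕ Fin r) ℂ[X]) : Prop :=
  ∃ T : Realization (Fin m × Fin n) r,
    (∃ 𝒳 𝒴 : Matrix (Fin m × Fin n) (Fin m × Fin n) ℂ,
      T.P = 𝒳.map Polynomial.C - (X : ℂ[X]) • 𝒴.map Polynomial.C) ∧
    L = T.systemMatrix ∧
    T.IsMinimal ∧
    -- (a)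
    (∃ (U V : Matrix (Fin m × Fin n) (Fin m × Fin n) ℂ[X]) (U₀ V₀ : Matrix (Fin r) (Fin r) ℂ),
      IsUnimodular U ∧ IsUnimodular V ∧ IsUnit U₀.det ∧ IsUnit V₀.det ∧
      Matrix.fromBlocks U 0 0 (U₀.map Polynomial.C) * L *
          Matrix.fromBlocks V 0 0 (V₀.map Polynomial.C) =
        padIdentity m S.systemMatrix) ∧
    -- (b)
    (∃ Oℓ Oᵣ : Matrix (Fin m × Fin n) (Fin m × Fin n) (RatFunc ℂ),
      IsBiproper Oℓ ∧ IsBiproper Oᵣ ∧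
      Oℓ * ((RatFunc.X : RatFunc ℂ)⁻¹ • T.transferFunction) * Oᵣ =
        lastDiag m (((RatFunc.X : RatFunc ℂ) ^ m)⁻¹ • G))

/-! ### Fiedler matrices and generalized Fiedler pencils -/

section Fiedler

variable {n r : ℕ}

/-- `M_{-m}(Z) = diag(Z, I, …, I)`. -/
def firstDiag (m : ℕ) (Z : Matrix (Fin n) (Fin n) ℂ) :
    Matrix (Fin m × Fin n) (Fin m × Fin n) ℂ :=
  Matrix.of fun i j =>
    (if i.1 = j.1 then if (i.1 : ℕ) = 0 then Z else 1 else 0 :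
      Matrix (Fin n) (Fin n) ℂ) i.2 j.2

/-- `M_i(Z) = diag(I_{(m-i-1)n}, [Z, I; I, 0], I_{(i-1)n})`, for `1 ≤ i ≤ m - 1`. -/
def elementary (m i : ℕ) (Z : Matrix (Fin n) (Fin n) ℂ) :
    Matrix (Fin m × Fin n) (Fin m × Fin n) ℂ :=
  Matrix.of fun a b =>
    (if (a.1 : ℕ) + i + 1 = m ∧ (b.1 : ℕ) + i + 1 = m then Z
    else if (a.1 : ℕ) + i + 1 = m ∧ (b.1 : ℕ) + i = m then 1
    else if (a.1 : ℕ) + i = m ∧ (b.1 : ℕ) + i + 1 = m then 1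
    else if (a.1 : ℕ) + i = m ∧ (b.1 : ℕ) + i = m then 0
    else if a.1 = b.1 then 1
    else 0 : Matrix (Fin n) (Fin n) ℂ) a.2 b.2

/-- The Fiedler matrix with index `0`: `[M_0(-A_0), -(e_m ⊗ C); -(e_mᵀ ⊗ B), -A]`. -/
noncomputable def fiedlerZero (m : ℕ) (S : Realization (Fin n) r) :
    Matrix ((Fin m × Fin n) ⊕ Fin r) ((Fin m × Fin n) ⊕ Fin r) ℂ :=
  Matrix.fromBlocks (lastDiag m (-S.coeff 0)) (-lastCol m S.C) (-lastRow m S.B) (-S.A)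

/-- The Fiedler matrix with index `i`, for `1 ≤ i ≤ m - 1`: `diag(M_i(-A_i), I_r)`. -/
noncomputable def fiedlerPos (m : ℕ) (S : Realization (Fin n) r) (i : ℕ) :
    Matrix ((Fin m × Fin n) ⊕ Fin r) ((Fin m × Fin n) ⊕ Fin r) ℂ :=
  Matrix.fromBlocks (elementary m i (-S.coeff i)) 0 0 1

/-- The Fiedler matrix with index `-m`: `diag(M_{-m}(A_m), -E)`. -/
noncomputable def fiedlerNegTop (m : ℕ) (S : Realization (Fin n) r) :
    Matrix ((Fin m × Fin n) ⊕ Fin r) ((Fin m × Fin n) ⊕ Fin r) ℂ :=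
  Matrix.fromBlocks (firstDiag m (S.coeff m)) 0 0 (-S.E)

/-- The Fiedler matrix with index `i`, for `-m ≤ i ≤ m`.  The ones with index `-1, …, -(m-1)` are
the inverses of those with index `1, …, m-1`, and the one with index `m` is the inverse of the one
with index `-m` (to be used only if `A_m` is nonsingular). -/
noncomputable def fiedler (m : ℕ) (S : Realization (Fin n) r) (i : ℤ) :
    Matrix ((Fin m × Fin n) ⊕ Fin r) ((Fin m × Fin n) ⊕ Fin r) ℂ :=
  if i = 0 then fiedlerZero m S
  else if i = -(m : ℤ) then fiedlerNegTop m S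
  else if i = (m : ℤ) then (fiedlerNegTop m S)⁻¹
  else if 0 < i then fiedlerPos m S i.natAbs
  else (fiedlerPos m S i.natAbs)⁻¹

/-- The product of the Fiedler matrices with indices `t = (t₁, …, t_k)`, in this order; the
identity if `t` is empty. -/
noncomputable def fiedlerProd (m : ℕ) (S : Realization (Fin n) r) (t : List ℤ) :
    Matrix ((Fin m × Fin n) ⊕ Fin r) ((Fin m × Fin n) ⊕ Fin r) ℂ :=
  (t.map (fiedler m S)).prod

/-- The generalized Fiedler pencil `λ M_{-ω₁} - M_{ω₀}`. -/
noncomputable def gfp (m : ℕ) (S : Realization (Fin n) r) (ω₀ ω₁ : List ℕ) :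
    Matrix ((Fin m × Fin n) ⊕ Fin r) ((Fin m × Fin n) ⊕ Fin r) ℂ[X] :=
  (X : ℂ[X]) • (fiedlerProd m S (ω₁.map fun k => -(k : ℤ))).map Polynomial.C -
    (fiedlerProd m S (ω₀.map fun k => (k : ℤ))).map Polynomial.C

end Fiedler

end RatMat

/-! Write `P = ∑ λ ^ j A_j` and work with `m × m` matrices over the ring of `n × n` blocks.

*Reduction.* Let `ω₀ = (σ₁, 0, σ₂)`. The Fiedler matrices with nonzero index are
`diag(invertible, invertible)` in the partition of the system matrix, so that
`𝕋_ω = M_{σ₁} (λ M_{-τ} - M_0) M_{σ₂}` with `τ = (σ₁ reversed, ω₁, σ₂ reversed)` is strictly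
equivalent to `λ M_{-τ} - M_0`, and such an equivalence preserves Rosenbrock strong linearizations.
Here `τ = (α, m, β)` is a permutation of `1, …, m`.

*Finite structure.* The matrix with index `m - 1` in `α` or `β` can be cleared from `λ M_{-τ} - M_0`
by invertible operations which fix the last block column, respectively the last block row, at the
price of replacing the coefficients `A_{m-1}, A_m` by the single one `A_{m-1} + λ A_m`. Iterating
this Horner step leaves `diag(I, P)`. As the operations fix the blocks `C` and `B`, they turn the
pencil into `diag(I, 𝒮)`; and minimality passes from `𝒮` to the pencil, because every realization
of the transfer function of the pencil yields one of `G` of the same size.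

*Structure at infinity.* The transfer function of the pencil is `λ W - diag(I, -F)`, where `W` is
the leading block of `M_{-τ}` and `F = A_0 + C (λ E - A)⁻¹ B` is proper. Over the ring of proper
rational functions, multiplication by the inverses of `M_{-α}` and `M_{-β}` turns
`W - λ⁻¹ diag(I, -F)` into a pencil of the same kind in the variable `λ⁻¹`, for the coefficients in
reverse order. The elimination above, applied to it, leaves `diag(I, λ⁻ᵐ G)`, and the invertible
matrices over the ring of proper rational functions are the biproper ones.
-/

namespace RatMat

open Polynomial Matrix Finset

section BlockElimination

variable {𝓐 κ : Type*} [Ring 𝓐] [DecidableEq κ]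

/-- The identity matrix with the rows and columns `p`, `q` replaced by `[0, 1; 1, z]`; it is a
Fiedler matrix with index `±i` when `p` and `q` are adjacent. -/
def swapBlock (p q : κ) (z : 𝓐) : Matrix κ κ 𝓐 :=
  1 + (single p q 1 + single q p 1 + single q q (z - 1) - single p p 1)

/-- The product of the matrices `[0, 1; 1, A_j]` in the positions `pos j`, `pos (j - 1)`, for `j`
in a list: for suitable positions, the product `M_{-α}` of Fiedler matrices. -/
def swapProd [Fintype κ] (pos : ℕ → κ) (A : ℕ → 𝓐) (α : List ℕ) : Matrix κ κ 𝓐 :=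
  (α.map fun j => swapBlock (pos j) (pos (j - 1)) (A j)).prod

/-- The identity matrix with the diagonal entry `p` replaced by `z`. -/
def corner (p : κ) (z : 𝓐) : Matrix κ κ 𝓐 :=
  diagonal (Pi.mulSingle p z)

/-- The diagonal matrix with entries `1` at `pos 0, …, pos (k - 1)`, entry `z` at `pos k`, and
`0` elsewhere. -/
noncomputable def truncDiag (pos : ℕ → κ) (k : ℕ) (z : 𝓐) : Matrix κ κ 𝓐 :=
  diagonal ((pos '' Set.Iio k).indicator 1) + single (pos k) (pos k) z

/-- The coefficient `M_α diag(1, …, 1, z, 0, …, 0) M_β` of the variable in a truncated Fiedler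
pencil; the truncation is what the induction on the degree runs over. -/
noncomputable def fiedlerLeading [Fintype κ] (pos : ℕ → κ) (A : ℕ → 𝓐) (k : ℕ) (z : 𝓐)
    (α β : List ℕ) : Matrix κ κ 𝓐 :=
  swapProd pos A α * truncDiag pos k z * swapProd pos A β

/-- Equivalence of matrices by invertible transformations that fix the column, respectively the
row, with index `p`.  These are the transformations that extend by the identity to a system matrix
coupled to its state only through the index `p`. -/
def CornerEquivalent [Fintype κ] (p : κ) (X Y : Matrix κ κ 𝓐) : Prop :=
  ∃ U V : Matrix κ κ 𝓐, IsUnit U ∧ IsUnit V ∧ U * single p p 1 = single p p 1 ∧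
    single p p 1 * V = single p p 1 ∧ U * X * V = Y

section Corner

theorem corner_one (p : κ) : corner p (1 : 𝓐) = 1 := by
  rw [corner, Pi.mulSingle_one]
  exact diagonal_one

theorem corner_add (p : κ) (z w : 𝓐) : corner p (z + w) = corner p z + single p p w := by
  ext i j
  by_cases h : i = j <;> by_cases hi : i = p <;>
    simp_all [corner, diagonal_apply, single_apply, eq_comm]

variable [Fintype κ]

theorem corner_mul (p : κ) (z w : 𝓐) : corner p z * corner p w = corner p (z * w) := by
  rw [corner, corner, diagonal_mul_diagonal, corner, Pi.mulSingle_mul]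
  rfl

theorem isUnit_corner {p : κ} {z : 𝓐} (hz : IsUnit z) : IsUnit (corner p z) := by
  obtain ⟨z, rfl⟩ := hz
  refine isUnit_iff_exists.2 ⟨corner p ↑z⁻¹, ?_, ?_⟩ <;> simp [corner_mul, corner_one]

end Corner

section Single

variable [Fintype κ]

theorem single_mul_diagonal (i j : κ) (c : 𝓐) (d : κ → 𝓐) :
    single i j c * diagonal d = single i j (c * d j) := by
  ext a b
  by_cases h : j = b <;> simp [single_apply, mul_diagonal, h]

theorem diagonal_mul_single (i j : κ) (c : 𝓐) (d : κ → 𝓐) :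
    diagonal d * single i j c = single i j (d i * c) := by
  ext a b
  by_cases h : i = a <;> simp [single_apply, diagonal_mul, h]

theorem swapBlock_mul_swapBlock {p q : κ} (h : p ≠ q) (z : 𝓐) :
    swapBlock p q z * swapBlock q p (-z) = 1 := by
  simp only [swapBlock, mul_add, add_mul, mul_sub, sub_mul, mul_one, one_mul,
    single_mul_single_same, single_mul_single_of_ne _ _ _ _ h,
    single_mul_single_of_ne _ _ _ _ h.symm]
  simp only [sub_eq_add_neg, single_add, ← single_neg]
  abel

theorem isUnit_swapBlock {p q : κ} (h : p ≠ q) (z : 𝓐) : IsUnit (swapBlock p q z) :=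
  isUnit_iff_exists.2 ⟨swapBlock q p (-z), swapBlock_mul_swapBlock h z, by
    simpa using swapBlock_mul_swapBlock h.symm (-z)⟩

theorem single_mul_swapBlock_left {p q : κ} (h : p ≠ q) (x : κ) (c z : 𝓐) :
    single x p c * swapBlock p q z = single x q c := by
  simp [swapBlock, mul_add, mul_sub, single_mul_single_of_ne _ _ _ _ h]

theorem single_mul_swapBlock_right {p q : κ} (h : p ≠ q) (x : κ) (c z : 𝓐) :
    single x q c * swapBlock p q z = single x p c + single x q (c * z) := by
  simp only [swapBlock, mul_add, mul_one, single_mul_single_same,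
    single_mul_single_of_ne _ _ _ _ h.symm, sub_eq_add_neg, single_add, ← single_neg, mul_neg]
  abel

theorem single_mul_swapBlock_of_ne {p q y : κ} (hp : y ≠ p) (hq : y ≠ q) (x : κ) (c z : 𝓐) :
    single x y c * swapBlock p q z = single x y c := by
  simp [swapBlock, mul_add, mul_sub, single_mul_single_of_ne _ _ _ _ hp,
    single_mul_single_of_ne _ _ _ _ hq]

theorem swapBlock_mul_single_left {p q : κ} (h : p ≠ q) (x : κ) (c z : 𝓐) :
    swapBlock p q z * single p x c = single q x c := by
  simp [swapBlock, add_mul, sub_mul, single_mul_single_of_ne _ _ _ _ h.symm]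

theorem swapBlock_mul_single_right {p q : κ} (h : p ≠ q) (x : κ) (c z : 𝓐) :
    swapBlock p q z * single q x c = single p x c + single q x (z * c) := by
  simp only [swapBlock, add_mul, one_mul, single_mul_single_same,
    single_mul_single_of_ne _ _ _ _ h, sub_eq_add_neg, single_add, ← single_neg, neg_mul]
  abel

theorem swapBlock_mul_single_of_ne {p q y : κ} (hp : p ≠ y) (hq : q ≠ y) (x : κ) (c z : 𝓐) :
    swapBlock p q z * single y x c = single y x c := by
  simp [swapBlock, add_mul, sub_mul, single_mul_single_of_ne _ _ _ _ hp,
    single_mul_single_of_ne _ _ _ _ hq]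

theorem diagonal_mul_swapBlock {p q : κ} {d : κ → 𝓐} (hp : d p = 0) (hq : d q = 0) (z : 𝓐) :
    diagonal d * swapBlock p q z = diagonal d := by
  simp [swapBlock, mul_add, mul_sub, diagonal_mul_single, hp, hq]

theorem swapBlock_mul_diagonal {p q : κ} {d : κ → 𝓐} (hp : d p = 0) (hq : d q = 0) (z : 𝓐) :
    swapBlock p q z * diagonal d = diagonal d := by
  simp [swapBlock, add_mul, sub_mul, single_mul_diagonal, hp, hq]

theorem commute_diagonal_swapBlock {p q : κ} {d : κ → 𝓐} (hp : d p = 1) (hq : d q = 1) (z : 𝓐) :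
    Commute (diagonal d) (swapBlock p q z) := by
  simp [commute_iff_eq, swapBlock, mul_add, add_mul, mul_sub, sub_mul, diagonal_mul_single,
    single_mul_diagonal, hp, hq]

theorem swapProd_append (pos : ℕ → κ) (A : ℕ → 𝓐) (α β : List ℕ) :
    swapProd pos A (α ++ β) = swapProd pos A α * swapProd pos A β := by
  simp [swapProd]

theorem swapProd_cons (pos : ℕ → κ) (A : ℕ → 𝓐) (j : ℕ) (α : List ℕ) :
    swapProd pos A (j :: α) = swapBlock (pos j) (pos (j - 1)) (A j) * swapProd pos A α := by
  simp [swapProd]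

end Single

section CornerEquivalent

variable [Fintype κ] {p : κ} {X Y Z : Matrix κ κ 𝓐}

theorem CornerEquivalent.refl (p : κ) (X : Matrix κ κ 𝓐) : CornerEquivalent p X X :=
  ⟨1, 1, isUnit_one, isUnit_one, one_mul _, mul_one _, by rw [one_mul, mul_one]⟩

theorem CornerEquivalent.trans (h₁ : CornerEquivalent p X Y) (h₂ : CornerEquivalent p Y Z) :
    CornerEquivalent p X Z := by
  obtain ⟨U₁, V₁, hU₁, hV₁, eU₁, eV₁, rfl⟩ := h₁
  obtain ⟨U₂, V₂, hU₂, hV₂, eU₂, eV₂, rfl⟩ := h₂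
  exact ⟨U₂ * U₁, V₁ * V₂, hU₂.mul hU₁, hV₁.mul hV₂, by rw [mul_assoc, eU₁, eU₂],
    by rw [← mul_assoc, eV₁, eV₂], by simp only [mul_assoc]⟩

end CornerEquivalent

section Truncation

variable {pos : ℕ → κ} {k : ℕ}

theorem truncDiag_zero (pos : ℕ → κ) (z : 𝓐) : truncDiag pos 0 z = single (pos 0) (pos 0) z := by
  simp [truncDiag]

theorem truncDiag_add (pos : ℕ → κ) (k : ℕ) (z w : 𝓐) :
    truncDiag pos k (z + w) = truncDiag pos k z + single (pos k) (pos k) w := by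
  rw [truncDiag, single_add, ← add_assoc, truncDiag]

theorem truncDiag_eq_corner {M : ℕ} (hpos : Set.BijOn pos (Set.Iic M) Set.univ) (z : 𝓐) :
    truncDiag pos M z = corner (pos M) z := by
  have himage : pos '' Set.Iio M = {pos M}ᶜ := by
    rw [← Set.Iic_sdiff_right, hpos.injOn.image_sdiff_subset (by simp), hpos.image_eq,
      Set.image_singleton, Set.compl_eq_univ_sdiff]
  rw [truncDiag, himage, ← diagonal_single, diagonal_add, corner]
  congr 1
  ext i
  by_cases hi : i = pos M <;> simp [hi]

theorem map_truncDiag {𝓑 : Type*} [Ring 𝓑] (f : 𝓐 →+* 𝓑) (pos : ℕ → κ) (k : ℕ) (z : 𝓐) :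
    (truncDiag pos k z).map f = truncDiag pos k (f z) := by
  rw [truncDiag, Matrix.map_add f (map_add f), diagonal_map (map_zero f), map_single, truncDiag]
  congr 2
  ext i
  by_cases hi : i ∈ pos '' Set.Iio k <;> simp [Set.indicator, hi]

theorem map_swapBlock {𝓑 : Type*} [Ring 𝓑] (f : 𝓐 →+* 𝓑) (p q : κ) (z : 𝓐) :
    (swapBlock p q z).map f = swapBlock p q (f z) := by
  simp only [swapBlock, Matrix.map_add f (map_add f), Matrix.map_sub f (map_sub f), map_single,
    map_one, map_sub, Matrix.map_one f (map_zero f) (map_one f)]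

theorem map_fiedlerLeading [Fintype κ] {𝓑 : Type*} [Ring 𝓑] (f : 𝓐 →+* 𝓑) (pos : ℕ → κ)
    (A : ℕ → 𝓐) (k : ℕ) (z : 𝓐) (α β : List ℕ) :
    (fiedlerLeading pos A k z α β).map f = fiedlerLeading pos (fun j => f (A j)) k (f z) α β := by
  have hprod (α : List ℕ) : (swapProd pos A α).map f = swapProd pos (fun j => f (A j)) α := by
    simp only [swapProd, ← RingHom.mapMatrix_apply, map_list_prod, List.map_map]
    exact congrArg _ (List.map_congr_left fun j _ => map_swapBlock f _ _ _)
  simp only [fiedlerLeading, Matrix.map_mul, hprod, map_truncDiag]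

section Injective

variable (hpos : Set.InjOn pos (Set.Iic (k + 1)))
include hpos

omit [DecidableEq κ] in
theorem pos_ne {i j : ℕ} (hi : i ≤ k + 1) (hj : j ≤ k + 1) (h : i ≠ j) : pos i ≠ pos j :=
  hpos.ne hi hj h

omit [DecidableEq κ] in
theorem pos_mem_image_Iio_iff {i j : ℕ} (hi : i ≤ k + 1) (hj : j ≤ k + 1) :
    pos i ∈ pos '' Set.Iio j ↔ i < j :=
  hpos.mem_image_iff (fun _ h => (Set.mem_Iio.1 h).le.trans hj) hi

theorem truncDiag_succ (z : 𝓐) :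
    truncDiag pos (k + 1) z = truncDiag pos k 1 + single (pos (k + 1)) (pos (k + 1)) z := by
  have hnot : pos k ∉ pos '' Set.Iio k := by
    rw [pos_mem_image_Iio_iff hpos (by omega) (by omega)]
    exact lt_irrefl k
  have himage : pos '' Set.Iio (k + 1) = insert (pos k) (pos '' Set.Iio k) := by
    rw [← Set.image_insert_eq]
    congr 1
    ext
    simp only [Set.mem_Iio, Set.mem_insert_iff]
    omega
  rw [truncDiag, truncDiag, himage, ← diagonal_single (pos k), diagonal_add]
  congr 2
  ext i
  by_cases hi : i = pos k
  · simp [hi, hnot]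
  · simp [Set.indicator, hi]

variable [Fintype κ]

theorem truncDiag_mul_swapBlock (z A : 𝓐) :
    truncDiag pos (k + 1) z * swapBlock (pos (k + 1)) (pos k) A =
      truncDiag pos k A + single (pos k) (pos (k + 1)) 1 + single (pos (k + 1)) (pos k) z := by
  have hne := pos_ne hpos (i := k + 1) (j := k) le_rfl (by omega) (by omega)
  rw [truncDiag_succ hpos, truncDiag, add_mul, add_mul, single_mul_swapBlock_right hne,
    single_mul_swapBlock_left hne, diagonal_mul_swapBlock, truncDiag, one_mul]
  · abel
  all_goals simp [pos_mem_image_Iio_iff hpos, -Set.mem_image]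

theorem swapBlock_mul_truncDiag (z A : 𝓐) :
    swapBlock (pos (k + 1)) (pos k) A * truncDiag pos (k + 1) z =
      truncDiag pos k A + single (pos k) (pos (k + 1)) z + single (pos (k + 1)) (pos k) 1 := by
  have hne := pos_ne hpos (i := k + 1) (j := k) le_rfl (by omega) (by omega)
  rw [truncDiag_succ hpos, truncDiag, mul_add, mul_add, swapBlock_mul_single_right hne,
    swapBlock_mul_single_left hne, swapBlock_mul_diagonal, truncDiag, mul_one]
  · abel
  all_goals simp [pos_mem_image_Iio_iff hpos, -Set.mem_image]

theorem single_mul_truncDiag (x : κ) (c z : 𝓐) :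
    single x (pos (k + 1)) c * truncDiag pos k z = 0 := by
  rw [truncDiag, mul_add, single_mul_diagonal, single_mul_single_of_ne, add_zero]
  · simp [pos_mem_image_Iio_iff hpos, -Set.mem_image]
  · exact pos_ne hpos le_rfl (by omega) (by omega)

theorem truncDiag_mul_single (x : κ) (c z : 𝓐) :
    truncDiag pos k z * single (pos (k + 1)) x c = 0 := by
  rw [truncDiag, add_mul, diagonal_mul_single, single_mul_single_of_ne, add_zero]
  · simp [pos_mem_image_Iio_iff hpos, -Set.mem_image]
  · exact pos_ne hpos (by omega) le_rfl (by omega)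

variable {α : List ℕ} (hα : ∀ j ∈ α, j ≤ k)
include hα

theorem single_mul_swapProd (A : ℕ → 𝓐) (x : κ) (c : 𝓐) :
    single x (pos (k + 1)) c * swapProd pos A α = single x (pos (k + 1)) c := by
  refine List.prod_induction (fun N => single x (pos (k + 1)) c * N = single x (pos (k + 1)) c)
    (fun N N' h h' => by rw [← mul_assoc, h, h']) (mul_one _) fun N hN => ?_
  obtain ⟨j, hj, rfl⟩ := List.mem_map.1 hN
  have := hα j hj
  exact single_mul_swapBlock_of_ne (pos_ne hpos le_rfl (by omega) (by omega))
    (pos_ne hpos le_rfl (by omega) (by omega)) _ _ _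

theorem swapProd_mul_single (A : ℕ → 𝓐) (x : κ) (c : 𝓐) :
    swapProd pos A α * single (pos (k + 1)) x c = single (pos (k + 1)) x c := by
  refine List.prod_induction (fun N => N * single (pos (k + 1)) x c = single (pos (k + 1)) x c)
    (fun N N' h h' => by rw [mul_assoc, h', h]) (one_mul _) fun N hN => ?_
  obtain ⟨j, hj, rfl⟩ := List.mem_map.1 hN
  have := hα j hj
  exact swapBlock_mul_single_of_ne (pos_ne hpos (by omega) le_rfl (by omega))
    (pos_ne hpos (by omega) le_rfl (by omega)) _ _ _

theorem commute_truncDiag_swapProd (A : ℕ → 𝓐) (z : 𝓐) :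
    Commute (truncDiag pos (k + 1) z) (swapProd pos A α) := by
  refine Commute.add_left (Commute.list_prod_right _ _ fun N hN => ?_) ?_
  · obtain ⟨j, hj, rfl⟩ := List.mem_map.1 hN
    have := hα j hj
    apply commute_diagonal_swapBlock <;> rw [Set.indicator_of_mem, Pi.one_apply] <;>
      exact Set.mem_image_of_mem _ (Set.mem_Iio.2 (by omega))
  · rw [commute_iff_eq, single_mul_swapProd hpos hα, swapProd_mul_single hpos hα]

end Injective

end Truncation

section Permutations

theorem perm_range'_of_perm_range'_succ {α β : List ℕ} {k : ℕ}
    (h : (α ++ (k + 1) :: β).Perm (List.range' 1 (k + 1))) : (α ++ β).Perm (List.range' 1 k) := by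
  rw [List.range'_concat, mul_comm, mul_one, add_comm 1 k] at h
  exact (List.perm_middle.symm.trans (h.trans (List.perm_append_singleton _ _))).cons_inv

theorem mem_bounds_of_perm_range' {α : List ℕ} {k : ℕ} (h : α.Perm (List.range' 1 k)) {j : ℕ}
    (hj : j ∈ α) : 1 ≤ j ∧ j ≤ k := by
  have := List.mem_range'_1.1 (h.mem_iff.1 hj)
  omega

theorem succ_mem_of_perm_range'_succ {α : List ℕ} {k : ℕ} (h : α.Perm (List.range' 1 (k + 1))) :
    k + 1 ∈ α :=
  h.mem_iff.2 (List.mem_range'_1.2 ⟨by omega, by omega⟩)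

theorem exists_append_cons_of_perm_range'_succ {α : List ℕ} {k : ℕ}
    (h : α.Perm (List.range' 1 (k + 1))) :
    ∃ α₁ α₂, α = α₁ ++ (k + 1) :: α₂ ∧ (α₁ ++ α₂).Perm (List.range' 1 k) := by
  obtain ⟨α₁, α₂, rfl⟩ := List.append_of_mem (succ_mem_of_perm_range'_succ h)
  exact ⟨α₁, α₂, rfl, perm_range'_of_perm_range'_succ h⟩

end Permutations

section Elimination

variable {R : Type*} [CommRing R]

theorem mul_sub_mul_eq_of_elimination {T : Type*} [Ring T] [Algebra R T] (l : R)
    {N N' D K x y : T} (hxN : x * N = x) (hxN' : x * N' = x) (hxK : x * K = x) (hxD : x * D = 0)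
    (hxx : x * x = 0) (hNy : N * y = y) (hNy' : N' * y = y) (hKy : K * y = y) (hDy : D * y = 0)
    (hyy : y * y = 0) :
    (1 + l • (N * x)) * (l • (N * (D + x + y) * N') - K) * (1 + l • (y * N')) =
      l • (N * (D + l • (x * y)) * N') - K := by
  have hx : N * x * (N * (D + x + y) * N') = N * (x * y) * N' := by
    rw [mul_assoc N, ← mul_assoc x, ← mul_assoc x, hxN, mul_add, mul_add, hxD, hxx, zero_add,
      zero_add, mul_assoc N]
  have hleft : (1 + l • (N * x)) * (l • (N * (D + x + y) * N') - K) =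
      l • (N * (D + l • (x * y)) * N') + l • (y * N') - K := by
    have hexpand : N * (D + x + y) * N' = N * D * N' + N * x + y * N' := by
      rw [mul_add, mul_add, hNy, add_mul, add_mul, mul_assoc N x, hxN']
    rw [add_mul, one_mul, smul_mul_assoc, mul_sub, mul_smul_comm, hx, mul_assoc N x K, hxK,
      hexpand]
    simp only [mul_add, add_mul, smul_add, smul_sub, mul_smul_comm, smul_mul_assoc]
    abel
  have hy : (l • (N * (D + l • (x * y)) * N') + l • (y * N') - K) * y = -y := by
    simp only [sub_mul, add_mul, smul_mul_assoc, mul_assoc, hNy', hDy, hyy, hKy, smul_zero,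
      mul_zero, add_zero, zero_sub]
  rw [hleft, mul_add, mul_one, mul_smul_comm, ← mul_assoc, hy, neg_mul, smul_neg]
  abel

variable [Fintype κ] {pos : ℕ → κ} {k : ℕ}

/- The factor with index `k + 1` is moved to the truncated diagonal factor, past factors with
smaller indices, which commute with the latter. -/
theorem exists_fiedlerLeading_succ_eq (hpos : Set.InjOn pos (Set.Iic (k + 1))) (A : ℕ → 𝓐) (z : 𝓐)
    {α β : List ℕ} (hαβ : (α ++ β).Perm (List.range' 1 (k + 1))) :
    ∃ (α' β' : List ℕ) (x y : 𝓐), (α' ++ β').Perm (List.range' 1 k) ∧ x * y = z ∧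
      fiedlerLeading pos A (k + 1) z α β =
        swapProd pos A α' * (truncDiag pos k (A (k + 1)) + single (pos k) (pos (k + 1)) x +
          single (pos (k + 1)) (pos k) y) * swapProd pos A β' := by
  rcases List.mem_append.1 (succ_mem_of_perm_range'_succ hαβ) with h | h
  · obtain ⟨α₁, α₂, rfl⟩ := List.append_of_mem h
    have hperm : (α₁ ++ (α₂ ++ β)).Perm (List.range' 1 k) :=
      perm_range'_of_perm_range'_succ (by simpa using hαβ)
    have hcomm : Commute (truncDiag pos (k + 1) z) (swapProd pos A α₂) :=
      commute_truncDiag_swapProd hpos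
        (fun j hj => (mem_bounds_of_perm_range' hperm (by simp [hj])).2) A z
    refine ⟨α₁, α₂ ++ β, z, 1, hperm, mul_one z, ?_⟩
    simp only [fiedlerLeading, ← swapBlock_mul_truncDiag hpos, swapProd_append, swapProd_cons,
      mul_assoc, Nat.add_sub_cancel, ← hcomm.left_comm]
  · obtain ⟨β₁, β₂, rfl⟩ := List.append_of_mem h
    have hperm : ((α ++ β₁) ++ β₂).Perm (List.range' 1 k) :=
      perm_range'_of_perm_range'_succ (by simpa using hαβ)
    have hcomm : Commute (truncDiag pos (k + 1) z) (swapProd pos A β₁) :=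
      commute_truncDiag_swapProd hpos
        (fun j hj => (mem_bounds_of_perm_range' hperm (by simp [hj])).2) A z
    refine ⟨α ++ β₁, β₂, 1, z, hperm, one_mul z, ?_⟩
    simp only [fiedlerLeading, ← truncDiag_mul_swapBlock hpos, swapProd_append, swapProd_cons,
      mul_assoc, Nat.add_sub_cancel, hcomm.left_comm]

variable [Algebra R 𝓐] (l : R)

theorem cornerEquivalent_eliminate (hpos : Set.InjOn pos (Set.Iic (k + 1))) (A : ℕ → 𝓐)
    (A₀ A₁ x y : 𝓐) {α β : List ℕ} (hα : ∀ j ∈ α, j ≤ k) (hβ : ∀ j ∈ β, j ≤ k) :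
    CornerEquivalent (pos 0)
      (l • (swapProd pos A α * (truncDiag pos k A₁ + single (pos k) (pos (k + 1)) x +
        single (pos (k + 1)) (pos k) y) * swapProd pos A β) - corner (pos 0) A₀)
      (l • fiedlerLeading pos A k (A₁ + l • (x * y)) α β - corner (pos 0) A₀) := by
  have hne₀ : pos (k + 1) ≠ pos 0 := pos_ne hpos le_rfl (by omega) (by omega)
  have hne : pos (k + 1) ≠ pos k := pos_ne hpos le_rfl (by omega) (by omega)
  set ξ : Matrix κ κ 𝓐 := single (pos k) (pos (k + 1)) x with hξ
  set η : Matrix κ κ 𝓐 := single (pos (k + 1)) (pos k) y with hη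
  have hξα : ξ * swapProd pos A α = ξ := single_mul_swapProd hpos hα A _ _
  have hηβ : swapProd pos A β * η = η := swapProd_mul_single hpos hβ A _ _
  have hξξ : ξ * ξ = 0 := single_mul_single_of_ne _ _ _ _ hne _
  have hηη : η * η = 0 := single_mul_single_of_ne _ _ _ _ hne.symm _
  have hξη : ξ * η = single (pos k) (pos k) (x * y) := single_mul_single_same _ _ _ _ _
  have hUsq : l • (swapProd pos A α * ξ) * l • (swapProd pos A α * ξ) = 0 := by
    rw [smul_mul_smul_comm, mul_assoc, ← mul_assoc ξ, hξα, hξξ, mul_zero, smul_zero]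
  have hVsq : l • (η * swapProd pos A β) * l • (η * swapProd pos A β) = 0 := by
    rw [smul_mul_smul_comm, mul_assoc, ← mul_assoc _ η, hηβ, ← mul_assoc, hηη, zero_mul, smul_zero]
  refine ⟨1 + l • (swapProd pos A α * ξ), 1 + l • (η * swapProd pos A β),
    IsNilpotent.isUnit_one_add ⟨2, by rw [sq, hUsq]⟩,
    IsNilpotent.isUnit_one_add ⟨2, by rw [sq, hVsq]⟩, ?_, ?_, ?_⟩
  · rw [add_mul, one_mul, smul_mul_assoc, mul_assoc, hξ, single_mul_single_of_ne _ _ _ _ hne₀,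
      mul_zero, smul_zero, add_zero]
  · rw [mul_add, mul_one, mul_smul_comm, ← mul_assoc, hη,
      single_mul_single_of_ne _ _ _ _ hne₀.symm, zero_mul, smul_zero, add_zero]
  · rw [fiedlerLeading, truncDiag_add, ← smul_single, ← hξη]
    apply mul_sub_mul_eq_of_elimination l hξα (single_mul_swapProd hpos hβ A _ _) ?_
      (single_mul_truncDiag hpos _ _ _) hξξ (swapProd_mul_single hpos hα A _ _) hηβ ?_
      (truncDiag_mul_single hpos _ _ _) hηη
    · rw [corner, single_mul_diagonal, Pi.mulSingle_eq_of_ne hne₀, mul_one]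
    · rw [corner, diagonal_mul_single, Pi.mulSingle_eq_of_ne hne₀, one_mul]

theorem cornerEquivalent_neg_corner (A : ℕ → 𝓐) {k : ℕ} (hpos : Set.InjOn pos (Set.Iic k)) (z : 𝓐)
    {α β : List ℕ} (hαβ : (α ++ β).Perm (List.range' 1 k)) :
    CornerEquivalent (pos 0) (l • fiedlerLeading pos A k z α β - corner (pos 0) (-A 0))
      (-corner (pos 0) (-(∑ j ∈ range (k + 1), l ^ j • A j + l ^ (k + 1) • z))) := by
  induction k generalizing z α β with
  | zero =>
    obtain ⟨rfl, rfl⟩ : α = [] ∧ β = [] := by simpa using hαβ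
    have hbase : l • fiedlerLeading pos A 0 z [] [] - corner (pos 0) (-A 0) =
        -corner (pos 0) (-(∑ j ∈ range (0 + 1), l ^ j • A j + l ^ (0 + 1) • z)) := by
      simp only [fiedlerLeading, swapProd, truncDiag_zero, List.map_nil, List.prod_nil, one_mul,
        mul_one, smul_single, zero_add, range_one, sum_singleton, pow_zero, one_smul, pow_one,
        neg_add, corner_add, ← single_neg]
      abel
    rw [hbase]
    exact CornerEquivalent.refl _ _
  | succ k ih =>
    obtain ⟨α', β', x, y, hperm, rfl, hsplit⟩ := exists_fiedlerLeading_succ_eq hpos A z hαβ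
    have hle : ∀ j ∈ α' ++ β', j ≤ k := fun j hj => (mem_bounds_of_perm_range' hperm hj).2
    rw [hsplit]
    refine (cornerEquivalent_eliminate l hpos A _ _ x y (fun j hj => hle j (by simp [hj]))
      fun j hj => hle j (by simp [hj])).trans ?_
    convert ih (hpos.mono (Set.Iic_subset_Iic.2 (by omega))) (A (k + 1) + l • (x * y)) hperm
      using 4
    rw [sum_range_succ _ (k + 1), smul_add, smul_smul, ← pow_succ, add_assoc]

theorem cornerEquivalent_corner_sum (A : ℕ → 𝓐) {M : ℕ} (hpos : Set.InjOn pos (Set.Iic M))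
    {α β : List ℕ} (hαβ : (α ++ β).Perm (List.range' 1 M)) :
    CornerEquivalent (pos 0) (l • fiedlerLeading pos A M (A (M + 1)) α β - corner (pos 0) (-A 0))
      (corner (pos 0) (∑ j ∈ range (M + 2), l ^ j • A j)) := by
  refine (cornerEquivalent_neg_corner l A hpos (A (M + 1)) hαβ).trans
    ⟨-corner (pos 0) (-1), 1, (isUnit_corner isUnit_one.neg).neg, isUnit_one, ?_, mul_one _, ?_⟩
  · rw [neg_mul, corner, diagonal_mul_single, Pi.mulSingle_eq_same, neg_one_mul, ← single_neg,
      neg_neg]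
  · rw [mul_one, neg_mul_neg, corner_mul, neg_mul_neg, one_mul, sum_range_succ _ (M + 1)]

end Elimination

section Reversal

variable [Fintype κ] {M : ℕ} {pos : ℕ → κ}

theorem perm_range'_map_sub {α : List ℕ} (hα : α.Perm (List.range' 1 M)) :
    (α.map fun j => M + 1 - j).Perm (List.range' 1 M) := by
  refine (hα.map _).trans ((List.perm_ext_iff_of_nodup ?_ List.nodup_range').2 fun a => ?_)
  · refine List.Nodup.map_on (fun i hi j hj h => ?_) List.nodup_range'
    rw [List.mem_range'_1] at hi hj
    omega
  · simp only [List.mem_map, List.mem_range'_1]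
    exact ⟨fun ⟨i, hi, h⟩ => by omega, fun ha => ⟨M + 1 - a, by omega, by omega⟩⟩

omit [Fintype κ] [DecidableEq κ] in
theorem bijOn_sub (hpos : Set.BijOn pos (Set.Iic M) Set.univ) :
    Set.BijOn (fun j => pos (M - j)) (Set.Iic M) Set.univ :=
  hpos.comp (Set.BijOn.mk (fun j _ => Set.mem_Iic.2 (Nat.sub_le M j))
    (fun i hi j hj h => by simp only [Set.mem_Iic] at hi hj; omega)
    fun j hj => ⟨M - j, Set.mem_Iic.2 (Nat.sub_le M j), Nat.sub_sub_self hj⟩)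

theorem prod_map_mul_prod_map_reverse {ι T : Type*} [Monoid T] {f g : ι → T} {s : List ι}
    (h : ∀ i ∈ s, f i * g i = 1) : (s.map f).prod * (s.reverse.map g).prod = 1 := by
  induction s with
  | nil => simp
  | cons i s ih =>
    have ih := ih fun j hj => h j (List.mem_cons_of_mem i hj)
    rw [List.reverse_cons, List.map_append, List.prod_append, List.map_cons, List.prod_cons,
      mul_assoc, ← mul_assoc (s.map f).prod, ih, one_mul, List.map_singleton, List.prod_singleton,
      h i List.mem_cons_self]

theorem swapProd_reverse_mul_cancel (hpos : Set.InjOn pos (Set.Iic M)) (A : ℕ → 𝓐) {α : List ℕ}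
    (hα : ∀ j ∈ α, 1 ≤ j ∧ j ≤ M) :
    let N := swapProd (fun j => pos (M - j)) (fun j => -A (M + 1 - j))
      (α.reverse.map fun j => M + 1 - j)
    swapProd pos A α * N = 1 ∧ N * swapProd pos A α = 1 := by
  have hne : ∀ j ∈ α, pos j ≠ pos (j - 1) := fun j hj =>
    hpos.ne (Set.mem_Iic.2 (hα j hj).2) (Set.mem_Iic.2 (by have := hα j hj; omega))
      (by have := hα j hj; omega)
  have hN : swapProd (fun j => pos (M - j)) (fun j => -A (M + 1 - j))
      (α.reverse.map fun j => M + 1 - j) =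
      (α.reverse.map fun j => swapBlock (pos (j - 1)) (pos j) (-A j)).prod := by
    rw [swapProd, List.map_map]
    refine congrArg _ (List.map_congr_left fun j hj => ?_)
    obtain ⟨h₁, h₂⟩ := hα j (List.mem_reverse.1 hj)
    simp only [Function.comp_apply, show M - (M + 1 - j) = j - 1 by omega,
      show M - (M + 1 - j - 1) = j by omega, show M + 1 - (M + 1 - j) = j by omega]
  rw [hN, swapProd]
  refine ⟨prod_map_mul_prod_map_reverse fun j hj => swapBlock_mul_swapBlock (hne j hj) _, ?_⟩
  have h := prod_map_mul_prod_map_reverse (s := α.reverse)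
    fun j hj => swapBlock_mul_swapBlock (hne j (List.mem_reverse.1 hj)).symm (-A j)
  simpa only [List.reverse_reverse, neg_neg] using h

theorem exists_isUnit_mul_corner_mul (p q : κ) :
    ∃ U V : Matrix κ κ 𝓐, IsUnit U ∧ IsUnit V ∧ ∀ z, U * corner p z * V = corner q z := by
  rcases eq_or_ne p q with rfl | h
  · exact ⟨1, 1, isUnit_one, isUnit_one, fun z => by rw [one_mul, mul_one]⟩
  refine ⟨swapBlock p q 0, swapBlock q p 0, isUnit_swapBlock h 0, isUnit_swapBlock h.symm 0,
    fun z => ?_⟩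
  have hswap : swapBlock p q (0 : 𝓐) * swapBlock q p 0 = 1 := by
    simpa using swapBlock_mul_swapBlock h (0 : 𝓐)
  rw [← add_sub_cancel 1 z, corner_add, corner_add, corner_one, corner_one, mul_add, add_mul,
    mul_one, hswap, swapBlock_mul_single_left h, single_mul_swapBlock_right h.symm, mul_zero,
    single_zero, add_zero]

variable {R : Type*} [CommRing R] [Algebra R 𝓐] (l : R)

/- Multiplication by `M_α⁻¹` and `M_β⁻¹` exchanges the two coefficients of the pencil, and numbers
the blocks in the opposite order. -/
theorem exists_isUnit_mul_reversed_mul (hpos : Set.BijOn pos (Set.Iic M) Set.univ) (A : ℕ → 𝓐)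
    (g : 𝓐) {α β : List ℕ} (hαβ : (α ++ β).Perm (List.range' 1 M)) :
    ∃ U V : Matrix κ κ 𝓐, IsUnit U ∧ IsUnit V ∧
      U * (fiedlerLeading pos A M (A (M + 1)) α β - l • corner (pos 0) (-g)) * V =
        corner (pos 0) (∑ j ∈ range (M + 1), l ^ j • A (M + 1 - j) + l ^ (M + 1) • g) := by
  have hle : ∀ j ∈ α ++ β, 1 ≤ j ∧ j ≤ M := fun j hj => mem_bounds_of_perm_range' hαβ hj
  obtain ⟨hα, hα'⟩ :=
    swapProd_reverse_mul_cancel hpos.injOn A fun j hj => hle j (List.mem_append_left β hj)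
  obtain ⟨hβ, hβ'⟩ :=
    swapProd_reverse_mul_cancel hpos.injOn A fun j hj => hle j (List.mem_append_right α hj)
  have hperm : ((α.reverse.map fun j => M + 1 - j) ++ β.reverse.map fun j => M + 1 - j).Perm
      (List.range' 1 M) := by
    rw [← List.map_append]
    exact perm_range'_map_sub ((α.reverse_perm.append β.reverse_perm).trans hαβ)
  obtain ⟨U, V, hU, hV, -, -, h⟩ := cornerEquivalent_neg_corner l (fun j => -A (M + 1 - j))
    (bijOn_sub hpos).injOn (-g) hperm
  obtain ⟨U', V', hU', hV', h'⟩ := exists_isUnit_mul_corner_mul (𝓐 := 𝓐) (pos M) (pos 0)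
  simp only [fiedlerLeading, truncDiag_eq_corner (bijOn_sub hpos), truncDiag_eq_corner hpos,
    Nat.sub_zero, Nat.sub_self, neg_neg, smul_neg, sum_neg_distrib, ← neg_add] at h ⊢
  set N₁ := swapProd (fun j => pos (M - j)) (fun j => -A (M + 1 - j))
    (α.reverse.map fun j => M + 1 - j)
  set N₂ := swapProd (fun j => pos (M - j)) (fun j => -A (M + 1 - j))
    (β.reverse.map fun j => M + 1 - j)
  refine ⟨U' * (U * N₁), N₂ * V * V',
    hU'.mul (hU.mul (isUnit_iff_exists.2 ⟨_, hα', hα⟩)),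
    ((isUnit_iff_exists.2 ⟨_, hβ', hβ⟩).mul hV).mul hV', ?_⟩
  have hcancel : N₁ * (swapProd pos A α * corner (pos M) (A (M + 1)) * swapProd pos A β) * N₂ =
      corner (pos M) (A (M + 1)) := by
    rw [← mul_assoc, ← mul_assoc, hα', one_mul, mul_assoc, hβ, mul_one]
  have hreverse : U * (N₁ * (swapProd pos A α * corner (pos M) (A (M + 1)) * swapProd pos A β -
      l • corner (pos 0) (-g)) * N₂) * V =
      corner (pos M) (∑ j ∈ range (M + 1), l ^ j • A (M + 1 - j) + l ^ (M + 1) • g) := by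
    rw [mul_sub, sub_mul, hcancel, mul_smul_comm, smul_mul_assoc, ← neg_sub, mul_neg, neg_mul, h,
      neg_neg]
  rw [← h' (_ + _), ← hreverse]
  simp only [mul_assoc]

end Reversal

end BlockElimination

section Flatten

variable {M : ℕ} {ι R : Type*}

/-- Matrices of `ι × ι` blocks as matrices. -/
abbrev flatten (M : ℕ) (ι R : Type*) [Semiring R] [Fintype ι] [DecidableEq ι] :
    Matrix (Fin (M + 1)) (Fin (M + 1)) (Matrix ι ι R) ≃+*
      Matrix (Fin (M + 1) × ι) (Fin (M + 1) × ι) R :=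
  compRingEquiv (Fin (M + 1)) ι R

/-- The position, counted from the last block, of the block acted on by the Fiedler matrices with
indices `±j` and `±(j + 1)`. -/
def blockPos (M j : ℕ) : Fin (M + 1) :=
  ⟨M - j, by omega⟩

theorem bijOn_blockPos (M : ℕ) : Set.BijOn (blockPos M) (Set.Iic M) Set.univ := by
  refine ⟨Set.mapsTo_univ _ _, fun i hi j hj h => ?_, fun i _ => ⟨M - i, ?_, ?_⟩⟩
  · simp only [Set.mem_Iic, blockPos, Fin.mk.injEq] at hi hj h
    omega
  · exact Set.mem_Iic.2 (Nat.sub_le M i)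
  · exact Fin.ext (Nat.sub_sub_self (Nat.lt_succ_iff.1 i.2))

variable [Semiring R] [Fintype ι] [DecidableEq ι]

theorem flatten_map {R' : Type*} [Semiring R'] (f : R →+* R')
    (Y : Matrix (Fin (M + 1)) (Fin (M + 1)) (Matrix ι ι R)) :
    (flatten M ι R Y).map f = flatten M ι R' (Y.map f.mapMatrix) :=
  rfl

theorem flatten_smul (c : R) (Y : Matrix (Fin (M + 1)) (Fin (M + 1)) (Matrix ι ι R)) :
    flatten M ι R (c • Y) = c • flatten M ι R Y :=
  rfl

end Flatten

section Flatten

variable {M m : ℕ} {ι R : Type*} [Ring R] [Fintype ι] [DecidableEq ι]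

theorem lastDiag_eq_flatten (Z : Matrix ι ι R) :
    lastDiag (M + 1) Z = flatten M ι R (corner (blockPos M 0) Z) := by
  ext ⟨i, a⟩ ⟨j, b⟩
  have hi : i = blockPos M 0 ↔ (i : ℕ) + 1 = M + 1 := by
    simp only [blockPos, Fin.ext_iff]
    omega
  simp only [lastDiag, of_apply, compRingEquiv_apply, comp_apply, corner, diagonal_apply,
    Pi.mulSingle_apply, hi]

theorem firstDiag_eq_flatten {n : ℕ} (Z : Matrix (Fin n) (Fin n) ℂ) :
    firstDiag (M + 1) Z = flatten M (Fin n) ℂ (corner (blockPos M M) Z) := by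
  ext ⟨i, a⟩ ⟨j, b⟩
  have hi : i = blockPos M M ↔ (i : ℕ) = 0 := by
    simp only [blockPos, Fin.ext_iff]
    omega
  simp only [firstDiag, of_apply, compRingEquiv_apply, comp_apply, corner, diagonal_apply,
    Pi.mulSingle_apply, hi]

theorem elementary_eq_flatten {n i : ℕ} (h₁ : 1 ≤ i) (hi : i ≤ M) (Z : Matrix (Fin n) (Fin n) ℂ) :
    elementary (M + 1) i Z =
      flatten M (Fin n) ℂ (swapBlock (blockPos M (i - 1)) (blockPos M i) Z) := by
  ext ⟨x, a⟩ ⟨y, b⟩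
  have hp (x : Fin (M + 1)) : (x : ℕ) + i + 1 = M + 1 ↔ blockPos M i = x := by
    simp only [blockPos, Fin.ext_iff]
    omega
  have hq (x : Fin (M + 1)) : (x : ℕ) + i = M + 1 ↔ blockPos M (i - 1) = x := by
    simp only [blockPos, Fin.ext_iff]
    omega
  have hne : blockPos M (i - 1) ≠ blockPos M i := by
    simp only [blockPos, ne_eq, Fin.mk.injEq]
    omega
  simp only [elementary, of_apply, compRingEquiv_apply, comp_apply, swapBlock, Matrix.add_apply,
    Matrix.sub_apply, single_apply, one_apply, hp, hq]
  generalize blockPos M i = p at hne ⊢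
  generalize blockPos M (i - 1) = q at hne ⊢
  by_cases hxy : x = y <;> by_cases hpx : p = x <;> by_cases hpy : p = y <;>
    by_cases hqx : q = x <;> by_cases hqy : q = y <;> simp_all

theorem lastCol_eq_mul {k : Type*} (Z : Matrix ι k R) :
    lastCol m Z = lastCol m (1 : Matrix ι ι R) * Z := by
  ext i j
  by_cases hi : (i.1 : ℕ) + 1 = m <;> simp [lastCol, mul_apply, hi, one_apply]

theorem lastRow_eq_mul {k : Type*} (Z : Matrix k ι R) :
    lastRow m Z = Z * lastRow m (1 : Matrix ι ι R) := by
  ext i j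
  by_cases hj : (j.1 : ℕ) + 1 = m <;> simp [lastRow, mul_apply, hj, one_apply]

omit [DecidableEq ι] in
theorem lastRow_mul_lastCol {k l : Type*} (Y : Matrix k ι R) (Z : Matrix ι l R) :
    lastRow (M + 1) Y * lastCol (M + 1) Z = Y * Z := by
  ext i j
  simp only [mul_apply, lastRow, lastCol, of_apply, Fintype.sum_prod_type]
  rw [Fintype.sum_eq_single (Fin.last M) fun x hx => ?_]
  · simp
  · have : (x : ℕ) ≠ M := fun h => hx (Fin.ext h)
    simp [this]

theorem flatten_single (Z : Matrix ι ι R) :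
    flatten M ι R (single (blockPos M 0) (blockPos M 0) Z) =
      lastCol (M + 1) Z * lastRow (M + 1) (1 : Matrix ι ι R) := by
  ext ⟨i, a⟩ ⟨j, b⟩
  have hp (x : Fin (M + 1)) : (x : ℕ) + 1 = M + 1 ↔ x = blockPos M 0 := by
    simp only [blockPos, Fin.ext_iff]
    omega
  simp only [compRingEquiv_apply, comp_apply, mul_apply, lastRow, lastCol, of_apply, hp,
    single_apply, eq_comm (a := blockPos M 0)]
  by_cases hi : i = blockPos M 0 <;> by_cases hj : j = blockPos M 0 <;> simp [one_apply, hi, hj]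

theorem flatten_single_mul_lastCol {k : Type*} (Z : Matrix ι k R) :
    flatten M ι R (single (blockPos M 0) (blockPos M 0) 1) * lastCol (M + 1) Z =
      lastCol (M + 1) Z := by
  rw [flatten_single, Matrix.mul_assoc, lastRow_mul_lastCol, Matrix.one_mul, ← lastCol_eq_mul]

theorem lastRow_mul_flatten_single {k : Type*} (Z : Matrix k ι R) :
    lastRow (M + 1) Z * flatten M ι R (single (blockPos M 0) (blockPos M 0) 1) =
      lastRow (M + 1) Z := by
  rw [flatten_single, ← Matrix.mul_assoc, lastRow_mul_lastCol, Matrix.mul_one, ← lastRow_eq_mul]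

theorem flatten_mul_lastCol {U : Matrix (Fin (M + 1)) (Fin (M + 1)) (Matrix ι ι R)}
    (hU : U * single (blockPos M 0) (blockPos M 0) 1 = single (blockPos M 0) (blockPos M 0) 1)
    {k : Type*} (Z : Matrix ι k R) :
    flatten M ι R U * lastCol (M + 1) Z = lastCol (M + 1) Z := by
  rw [← flatten_single_mul_lastCol, ← Matrix.mul_assoc, ← map_mul, hU]

theorem lastRow_mul_flatten {V : Matrix (Fin (M + 1)) (Fin (M + 1)) (Matrix ι ι R)}
    (hV : single (blockPos M 0) (blockPos M 0) 1 * V = single (blockPos M 0) (blockPos M 0) 1)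
    {k : Type*} (Z : Matrix k ι R) :
    lastRow (M + 1) Z * flatten M ι R V = lastRow (M + 1) Z := by
  rw [← lastRow_mul_flatten_single, Matrix.mul_assoc, ← map_mul, hV]

theorem lastDiag_add (Z W : Matrix ι ι R) :
    lastDiag (M + 1) (Z + W) =
      lastDiag (M + 1) Z + lastCol (M + 1) W * lastRow (M + 1) (1 : Matrix ι ι R) := by
  rw [lastDiag_eq_flatten, corner_add, map_add, flatten_single, lastDiag_eq_flatten]

theorem lastRow_mul_lastDiag_mul_lastCol (Z : Matrix ι ι R) :
    lastRow (M + 1) (1 : Matrix ι ι R) * lastDiag (M + 1) Z *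
      lastCol (M + 1) (1 : Matrix ι ι R) = Z := by
  rw [← add_sub_cancel 1 Z, lastDiag_add, lastDiag_eq_flatten, corner_one, map_one, Matrix.mul_add,
    Matrix.mul_one, Matrix.add_mul, lastRow_mul_lastCol, ← Matrix.mul_assoc, lastRow_mul_lastCol,
    Matrix.mul_assoc, lastRow_mul_lastCol, Matrix.mul_one, Matrix.one_mul, Matrix.mul_one]

end Flatten

section Map

variable {m : ℕ} {ι κ R R' : Type*} [Semiring R] [Semiring R'] (f : R →+* R')

theorem map_lastDiag [DecidableEq ι] (Z : Matrix ι ι R) :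
    (lastDiag m Z).map f = lastDiag m (Z.map f) := by
  ext i j
  simp only [lastDiag, map_apply, of_apply]
  split_ifs <;> simp [one_apply, apply_ite f]

theorem map_lastCol (Z : Matrix ι κ R) : (lastCol m Z).map f = lastCol m (Z.map f) := by
  ext i j
  simp only [lastCol, map_apply, of_apply, apply_ite f, map_zero]

theorem map_lastRow (Z : Matrix κ ι R) : (lastRow m Z).map f = lastRow m (Z.map f) := by
  ext i j
  simp only [lastRow, map_apply, of_apply, apply_ite f, map_zero]

end Map

section ProperFunctions

open Filter Bornology Topology

theorem eventually_denom_eval₂_ne_zero (f : RatFunc ℂ) :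
    ∀ᶠ z in cobounded ℂ, f.denom.eval₂ (RingHom.id ℂ) z ≠ 0 := by
  have h : IsBounded {z | f.denom.IsRoot z} :=
    (Polynomial.finite_setOfPred_isRoot f.denom_ne_zero).isBounded
  exact isBounded_def.1 h

theorem eventually_eval_add (f g : RatFunc ℂ) : ∀ᶠ z in cobounded ℂ,
    f.eval (RingHom.id ℂ) z + g.eval (RingHom.id ℂ) z = (f + g).eval (RingHom.id ℂ) z := by
  filter_upwards [eventually_denom_eval₂_ne_zero f, eventually_denom_eval₂_ne_zero g] with z hf hg
  exact (RatFunc.eval_add _ _ hf hg).symm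

theorem eventually_eval_mul (f g : RatFunc ℂ) : ∀ᶠ z in cobounded ℂ,
    f.eval (RingHom.id ℂ) z * g.eval (RingHom.id ℂ) z = (f * g).eval (RingHom.id ℂ) z := by
  filter_upwards [eventually_denom_eval₂_ne_zero f, eventually_denom_eval₂_ne_zero g] with z hf hg
  exact (RatFunc.eval_mul _ _ hf hg).symm

theorem eventually_eval_inv {f : RatFunc ℂ} (hf : f ≠ 0) : ∀ᶠ z in cobounded ℂ,
    (f.eval (RingHom.id ℂ) z)⁻¹ = f⁻¹.eval (RingHom.id ℂ) z := by
  filter_upwards [eventually_eval_mul f f⁻¹] with z hz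
  rw [mul_inv_cancel₀ hf, RatFunc.eval_one] at hz
  exact inv_eq_of_mul_eq_one_right hz

/-- The rational function `f` has the limit `c` at infinity. -/
def HasLimit (f : RatFunc ℂ) (c : ℂ) : Prop :=
  Tendsto (fun z : ℂ => f.eval (RingHom.id ℂ) z) (cobounded ℂ) (𝓝 c)

theorem HasLimit.add {f g : RatFunc ℂ} {c d : ℂ} (hf : HasLimit f c) (hg : HasLimit g d) :
    HasLimit (f + g) (c + d) :=
  (Tendsto.add hf hg).congr' (eventually_eval_add f g)

theorem HasLimit.mul {f g : RatFunc ℂ} {c d : ℂ} (hf : HasLimit f c) (hg : HasLimit g d) :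
    HasLimit (f * g) (c * d) :=
  (Tendsto.mul hf hg).congr' (eventually_eval_mul f g)

theorem hasLimit_C (c : ℂ) : HasLimit (RatFunc.C c) c :=
  tendsto_const_nhds.congr fun z => by rw [RatFunc.eval_C, RingHom.id_apply]

theorem HasLimit.inv {f : RatFunc ℂ} {c : ℂ} (hf : HasLimit f c) (hc : c ≠ 0) :
    HasLimit f⁻¹ c⁻¹ := by
  have hf₀ : f ≠ 0 := by
    rintro rfl
    exact hc (tendsto_nhds_unique hf (by simp))
  exact (Tendsto.inv₀ hf hc).congr' (eventually_eval_inv hf₀)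

theorem hasLimit_X_inv : HasLimit RatFunc.X⁻¹ 0 := by
  refine tendsto_inv₀_cobounded.congr' ?_
  filter_upwards [eventually_eval_inv (RatFunc.X_ne_zero (K := ℂ))] with z hz
  rw [← hz, RatFunc.eval_X]

/-- The ring of proper rational functions, those which have a limit at infinity. -/
def properSubring : Subring (RatFunc ℂ) where
  carrier := {f | ∃ c, HasLimit f c}
  mul_mem' := fun ⟨_, hf⟩ ⟨_, hg⟩ => ⟨_, hf.mul hg⟩
  one_mem' := ⟨1, by simpa using hasLimit_C 1⟩
  add_mem' := fun ⟨_, hf⟩ ⟨_, hg⟩ => ⟨_, hf.add hg⟩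
  zero_mem' := ⟨0, by simpa using hasLimit_C 0⟩
  neg_mem' := fun {f} ⟨c, hf⟩ => ⟨-1 * c, by simpa using (hasLimit_C (-1)).mul hf⟩

/-- The value at infinity of a proper rational function. -/
noncomputable def valueAtInfinity : properSubring →+* ℂ where
  toFun f := f.2.choose
  map_one' := tendsto_nhds_unique (Exists.choose_spec (1 : properSubring).2)
    (by simp)
  map_mul' f g := tendsto_nhds_unique (f * g).2.choose_spec
    (HasLimit.mul f.2.choose_spec g.2.choose_spec)
  map_zero' := tendsto_nhds_unique (Exists.choose_spec (0 : properSubring).2)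
    (by simp)
  map_add' f g := tendsto_nhds_unique (f + g).2.choose_spec
    (HasLimit.add f.2.choose_spec g.2.choose_spec)

theorem hasLimit_valueAtInfinity (f : properSubring) : HasLimit f (valueAtInfinity f) :=
  f.2.choose_spec

theorem valueAtInfinity_eq {f : properSubring} {c : ℂ} (h : HasLimit f c) :
    valueAtInfinity f = c :=
  tendsto_nhds_unique (hasLimit_valueAtInfinity f) h

instance isLocalHom_valueAtInfinity : IsLocalHom valueAtInfinity where
  map_nonunit f h := by
    have hf : (f : RatFunc ℂ) ≠ 0 := fun hf => h.ne_zero (by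
      rw [show f = 0 from Subtype.ext hf, map_zero])
    exact IsUnit.of_mul_eq_one ⟨(f : RatFunc ℂ)⁻¹, _, (hasLimit_valueAtInfinity f).inv h.ne_zero⟩
      (Subtype.ext (mul_inv_cancel₀ hf))

/-- Constants as proper rational functions. -/
noncomputable def properConst : ℂ →+* properSubring :=
  (RatFunc.C (K := ℂ)).codRestrict properSubring fun c => ⟨c, hasLimit_C c⟩

/-- `1 / λ` as a proper rational function. -/
noncomputable def properXInv : properSubring :=
  ⟨RatFunc.X⁻¹, 0, hasLimit_X_inv⟩

variable {ι : Type*} [Fintype ι] [DecidableEq ι]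

theorem isUnit_of_isUnit_map_valueAtInfinity {F : Matrix ι ι properSubring}
    (h : IsUnit (F.map valueAtInfinity)) : IsUnit F := by
  rw [isUnit_iff_isUnit_det] at h ⊢
  exact isUnit_of_map_unit valueAtInfinity F.det (by rwa [RingHom.map_det])

theorem isBiproper_iff {F : Matrix ι ι (RatFunc ℂ)} :
    IsBiproper F ↔
      ∃ F' : Matrix ι ι properSubring, IsUnit F' ∧ F'.map properSubring.subtype = F := by
  refine ⟨fun ⟨D, hD, h⟩ => ?_, ?_⟩
  · have hF (i j : ι) : HasLimit (F i j) (D i j) := tendsto_pi_nhds.1 (tendsto_pi_nhds.1 h i) j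
    refine ⟨of fun i j => ⟨F i j, D i j, hF i j⟩, isUnit_of_isUnit_map_valueAtInfinity ?_, rfl⟩
    convert (isUnit_iff_isUnit_det D).2 hD
    exact Matrix.ext fun i j => valueAtInfinity_eq (hF i j)
  · rintro ⟨F, hF, rfl⟩
    refine ⟨F.map valueAtInfinity,
      (isUnit_iff_isUnit_det _).1 (hF.map valueAtInfinity.mapMatrix), ?_⟩
    exact tendsto_pi_nhds.2 fun i => tendsto_pi_nhds.2 fun j => hasLimit_valueAtInfinity (F i j)

theorem IsBiproper.mul {F F' : Matrix ι ι (RatFunc ℂ)} (hF : IsBiproper F) (hF' : IsBiproper F') :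
    IsBiproper (F * F') := by
  rw [isBiproper_iff] at *
  obtain ⟨F, hF, rfl⟩ := hF
  obtain ⟨F', hF', rfl⟩ := hF'
  exact ⟨F * F', hF.mul hF', Matrix.map_mul⟩

theorem isBiproper_map_C {D : Matrix ι ι ℂ} (hD : IsUnit D) : IsBiproper (D.map RatFunc.C) :=
  isBiproper_iff.2 ⟨D.map properConst, hD.map properConst.mapMatrix, rfl⟩

theorem isUnimodular_iff {U : Matrix ι ι ℂ[X]} : IsUnimodular U ↔ IsUnit U := by
  rw [isUnit_iff_isUnit_det, Polynomial.isUnit_iff]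
  simp only [IsUnimodular, isUnit_iff_ne_zero, eq_comm]

/-- `E - A / λ`, as a matrix of proper rational functions. -/
noncomputable def properPencil (E A : Matrix ι ι ℂ) : Matrix ι ι properSubring :=
  E.map properConst - properXInv • A.map properConst

theorem isUnit_properPencil {E : Matrix ι ι ℂ} (hE : IsUnit E) (A : Matrix ι ι ℂ) :
    IsUnit (properPencil E A) := by
  apply isUnit_of_isUnit_map_valueAtInfinity
  convert hE
  ext i j
  have hE := valueAtInfinity_eq (f := properConst (E i j)) (hasLimit_C _)
  have hX := valueAtInfinity_eq (f := properXInv) hasLimit_X_inv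
  simp [properPencil, hE, hX]

omit [Fintype ι] [DecidableEq ι] in
theorem X_smul_map_properPencil (E A : Matrix ι ι ℂ) :
    (RatFunc.X : RatFunc ℂ) • (properPencil E A).map properSubring.subtype =
      (RatFunc.X : RatFunc ℂ) • E.map RatFunc.C - A.map RatFunc.C := by
  ext i j
  change RatFunc.X * (RatFunc.C (E i j) - RatFunc.X⁻¹ * RatFunc.C (A i j)) =
    RatFunc.X * RatFunc.C (E i j) - RatFunc.C (A i j)
  rw [mul_sub, mul_inv_cancel_left₀ RatFunc.X_ne_zero]

theorem pencil_mul_map_properPencil_inv {E : Matrix ι ι ℂ} (hE : IsUnit E) (A : Matrix ι ι ℂ) :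
    ((RatFunc.X : RatFunc ℂ) • E.map RatFunc.C - A.map RatFunc.C) *
      (properXInv • (properPencil E A)⁻¹).map properSubring.subtype = 1 := by
  have hsmul : (properXInv • (properPencil E A)⁻¹).map properSubring.subtype =
      (RatFunc.X : RatFunc ℂ)⁻¹ • (properPencil E A)⁻¹.map properSubring.subtype :=
    rfl
  rw [← X_smul_map_properPencil, hsmul, smul_mul_smul_comm, mul_inv_cancel₀ RatFunc.X_ne_zero,
    one_smul, ← Matrix.map_mul,
    mul_nonsing_inv _ ((isUnit_iff_isUnit_det _).1 (isUnit_properPencil hE A)),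
    Matrix.map_one _ (map_zero properSubring.subtype) (map_one properSubring.subtype)]

theorem map_properPencil_inv {E : Matrix ι ι ℂ} (hE : IsUnit E) (A : Matrix ι ι ℂ) :
    (properXInv • (properPencil E A)⁻¹).map properSubring.subtype =
      ((RatFunc.X : RatFunc ℂ) • E.map RatFunc.C - A.map RatFunc.C)⁻¹ :=
  (inv_eq_right_inv (pencil_mul_map_properPencil_inv hE A)).symm

theorem isUnit_pencil {E : Matrix ι ι ℂ} (hE : IsUnit E) (A : Matrix ι ι ℂ) :
    IsUnit ((RatFunc.X : RatFunc ℂ) • E.map RatFunc.C - A.map RatFunc.C) :=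
  IsUnit.of_mul_eq_one _ (pencil_mul_map_properPencil_inv hE A)

end ProperFunctions

section SchurComplement

variable {ι κ ι' K : Type*} [Fintype κ] [DecidableEq κ] [CommRing K]

/-- The Schur complement of the lower right block.  The transfer function of a system matrix is
its Schur complement. -/
noncomputable def schurComplement (N : Matrix (ι ⊕ κ) (ι ⊕ κ) K) : Matrix ι ι K :=
  N.toBlocks₁₁ - N.toBlocks₁₂ * N.toBlocks₂₂⁻¹ * N.toBlocks₂₁

theorem schurComplement_mul_mul [Fintype ι] {N : Matrix (ι ⊕ κ) (ι ⊕ κ) K}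
    (hN : IsUnit N.toBlocks₂₂) (U : Matrix ι' ι K) (V : Matrix ι ι' K)
    (Q : Matrix ι' κ K) (Q' : Matrix κ ι' K)
    {U₀ V₀ : Matrix κ κ K} (hU₀ : IsUnit U₀) (hV₀ : IsUnit V₀) :
    schurComplement (fromBlocks U Q 0 U₀ * N * fromBlocks V 0 Q' V₀) =
      U * schurComplement N * V := by
  rw [isUnit_iff_isUnit_det] at hN hU₀ hV₀
  rw [← fromBlocks_toBlocks N, schurComplement, schurComplement]
  simp only [fromBlocks_multiply, toBlocks_fromBlocks₁₁, toBlocks_fromBlocks₁₂,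
    toBlocks_fromBlocks₂₁, toBlocks_fromBlocks₂₂, Matrix.zero_mul, Matrix.mul_zero, zero_add]
  generalize N.toBlocks₁₁ = P
  generalize N.toBlocks₁₂ = C
  generalize N.toBlocks₂₁ = B
  generalize N.toBlocks₂₂ = Z at hN
  have hcancel : (U * C + Q * Z) * V₀ * (U₀ * Z * V₀)⁻¹ * (U₀ * B * V + U₀ * Z * Q') =
      (U * C + Q * Z) * Z⁻¹ * (B * V + Z * Q') := by
    rw [Matrix.mul_inv_rev, Matrix.mul_inv_rev, ← Matrix.mul_assoc,
      mul_nonsing_inv_cancel_right _ _ hV₀, ← Matrix.mul_assoc, Matrix.mul_assoc U₀,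
      Matrix.mul_assoc U₀, ← Matrix.mul_add, ← Matrix.mul_assoc,
      nonsing_inv_mul_cancel_right _ _ hU₀]
  rw [hcancel]
  simp only [Matrix.mul_add, Matrix.add_mul, Matrix.mul_sub, Matrix.sub_mul,
    mul_nonsing_inv_cancel_right _ _ hN, Matrix.mul_assoc, nonsing_inv_mul_cancel_left _ _ hN]
  abel

end SchurComplement

section Division

variable {ι κ : Type*} [Finite ι] [Fintype κ] [DecidableEq κ] {E : Matrix κ κ ℂ}

theorem exists_eq_mul_pencil_add (hE : IsUnit E) (A : Matrix κ κ ℂ) (N : Matrix ι κ ℂ[X]) :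
    ∃ (Q : Matrix ι κ ℂ[X]) (D : Matrix ι κ ℂ),
      N = Q * ((X : ℂ[X]) • E.map Polynomial.C - A.map Polynomial.C) + D.map Polynomial.C := by
  classical
  have := Fintype.ofFinite ι
  set Z := (X : ℂ[X]) • E.map Polynomial.C - A.map Polynomial.C with hZ
  have hadd (N N' : Matrix ι κ ℂ[X])
      (h : ∃ (Q : Matrix ι κ ℂ[X]) (D : Matrix ι κ ℂ), N = Q * Z + D.map Polynomial.C)
      (h' : ∃ (Q : Matrix ι κ ℂ[X]) (D : Matrix ι κ ℂ), N' = Q * Z + D.map Polynomial.C) :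
      ∃ (Q : Matrix ι κ ℂ[X]) (D : Matrix ι κ ℂ), N + N' = Q * Z + D.map Polynomial.C := by
    obtain ⟨Q, D, rfl⟩ := h
    obtain ⟨Q', D', rfl⟩ := h'
    exact ⟨Q + Q', D + D', by
      rw [Matrix.add_mul, Matrix.map_add _ (map_add Polynomial.C), add_add_add_comm]⟩
  have hX (D : Matrix ι κ ℂ) : (X : ℂ[X]) • D.map Polynomial.C =
      (D * E⁻¹).map Polynomial.C * Z + (D * E⁻¹ * A).map Polynomial.C := by
    rw [hZ, Matrix.mul_sub, Matrix.mul_smul, ← Matrix.map_mul, ← Matrix.map_mul,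
      nonsing_inv_mul_cancel_right _ _ ((isUnit_iff_isUnit_det E).1 hE), sub_add_cancel]
  induction N using Matrix.induction_on' with
  | h_zero => exact ⟨0, 0, by simp⟩
  | h_add N N' hN hN' => exact hadd N N' hN hN'
  | h_std_basis i j p =>
    induction p using Polynomial.induction_on with
    | C a => exact ⟨0, single i j a, by rw [Matrix.zero_mul, zero_add, map_single]⟩
    | add p q hp hq =>
      rw [single_add]
      exact hadd _ _ hp hq
    | monomial k a h =>
      obtain ⟨Q, D, h⟩ := h
      have hpow : single i j (Polynomial.C a * X ^ (k + 1)) =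
          (X : ℂ[X]) • single i j (Polynomial.C a * X ^ k) := by
        rw [smul_single, smul_eq_mul, pow_succ', mul_left_comm]
      refine ⟨(X : ℂ[X]) • Q + (D * E⁻¹).map Polynomial.C, D * E⁻¹ * A, ?_⟩
      rw [hpow, h, smul_add, hX, Matrix.add_mul, Matrix.smul_mul, add_assoc]

theorem exists_eq_pencil_mul_add (hE : IsUnit E) (A : Matrix κ κ ℂ) (N : Matrix κ ι ℂ[X]) :
    ∃ (Q : Matrix κ ι ℂ[X]) (D : Matrix κ ι ℂ),
      N = ((X : ℂ[X]) • E.map Polynomial.C - A.map Polynomial.C) * Q + D.map Polynomial.C := by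
  obtain ⟨Q, D, h⟩ := exists_eq_mul_pencil_add ((isUnit_transpose E).2 hE) Aᵀ Nᵀ
  refine ⟨Qᵀ, Dᵀ, ?_⟩
  rw [← transpose_transpose N, h, transpose_add, transpose_mul]
  rfl

end Division

section Realization

variable {ι κ : Type*} {r : ℕ}

theorem map_C_map_algebraMap {k l : Type*} (D : Matrix k l ℂ) :
    (D.map Polynomial.C).map (algebraMap ℂ[X] (RatFunc ℂ)) = D.map RatFunc.C := by
  ext i j
  exact RatFunc.algebraMap_C _

theorem map_algebraMap_pencil {k l : Type*} (E A : Matrix k l ℂ) :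
    ((X : ℂ[X]) • E.map Polynomial.C - A.map Polynomial.C).map (algebraMap ℂ[X] (RatFunc ℂ)) =
      (RatFunc.X : RatFunc ℂ) • E.map RatFunc.C - A.map RatFunc.C := by
  ext i j
  simp only [map_apply, Matrix.sub_apply, Matrix.smul_apply, smul_eq_mul, map_sub, map_mul,
    RatFunc.algebraMap_X, RatFunc.algebraMap_C]

theorem map_algebraMap_systemMatrix (S : Realization ι r) :
    S.systemMatrix.map (algebraMap ℂ[X] (RatFunc ℂ)) =
      fromBlocks (S.P.map (algebraMap ℂ[X] (RatFunc ℂ))) (S.C.map RatFunc.C) (S.B.map RatFunc.C)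
        (-((RatFunc.X : RatFunc ℂ) • S.E.map RatFunc.C - S.A.map RatFunc.C)) := by
  rw [Realization.systemMatrix, ← neg_sub ((X : ℂ[X]) • _), fromBlocks_map,
    Matrix.map_neg _ (map_neg (algebraMap ℂ[X] (RatFunc ℂ))), map_algebraMap_pencil,
    map_C_map_algebraMap, map_C_map_algebraMap]

theorem isUnit_E (S : Realization ι r) : IsUnit S.E :=
  (isUnit_iff_isUnit_det _).2 S.nonsingular

theorem isUnit_toBlocks₂₂_systemMatrix (S : Realization ι r) :
    IsUnit (S.systemMatrix.map (algebraMap ℂ[X] (RatFunc ℂ))).toBlocks₂₂ := by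
  rw [map_algebraMap_systemMatrix, toBlocks_fromBlocks₂₂]
  exact (isUnit_pencil (isUnit_E S) _).neg

theorem transferFunction_eq_schurComplement (S : Realization ι r) :
    S.transferFunction = schurComplement (S.systemMatrix.map (algebraMap ℂ[X] (RatFunc ℂ))) := by
  have hZ := (isUnit_iff_isUnit_det _).1 (isUnit_pencil (isUnit_E S) S.A)
  rw [map_algebraMap_systemMatrix, schurComplement, toBlocks_fromBlocks₁₁, toBlocks_fromBlocks₁₂,
    toBlocks_fromBlocks₂₁, toBlocks_fromBlocks₂₂,
    inv_eq_right_inv ((neg_mul_neg _ _).trans (mul_nonsing_inv _ hZ)), Matrix.mul_neg,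
    Matrix.neg_mul, sub_neg_eq_add]
  rfl

variable [Fintype ι]

theorem transferFunction_eq_mul_mul {S : Realization ι r} {T : Realization κ r}
    {U : Matrix κ ι ℂ[X]} {V : Matrix ι κ ℂ[X]} {Q : Matrix κ (Fin r) ℂ[X]}
    {Q' : Matrix (Fin r) κ ℂ[X]} {U₀ V₀ : Matrix (Fin r) (Fin r) ℂ} (hU₀ : IsUnit U₀)
    (hV₀ : IsUnit V₀)
    (h : fromBlocks U Q 0 (U₀.map Polynomial.C) * S.systemMatrix *
      fromBlocks V 0 Q' (V₀.map Polynomial.C) = T.systemMatrix) :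
    T.transferFunction = U.map (algebraMap ℂ[X] (RatFunc ℂ)) * S.transferFunction *
      V.map (algebraMap ℂ[X] (RatFunc ℂ)) := by
  have hunit {D : Matrix (Fin r) (Fin r) ℂ} (hD : IsUnit D) :
      IsUnit ((D.map Polynomial.C).map (algebraMap ℂ[X] (RatFunc ℂ))) :=
    (hD.map (Polynomial.C (R := ℂ)).mapMatrix).map (algebraMap ℂ[X] (RatFunc ℂ)).mapMatrix
  rw [transferFunction_eq_schurComplement, transferFunction_eq_schurComplement, ← h,
    Matrix.map_mul, Matrix.map_mul, fromBlocks_map, fromBlocks_map,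
    Matrix.map_zero _ (map_zero (algebraMap ℂ[X] (RatFunc ℂ))),
    Matrix.map_zero _ (map_zero (algebraMap ℂ[X] (RatFunc ℂ))),
    schurComplement_mul_mul (isUnit_toBlocks₂₂_systemMatrix S) _ _ _ _ (hunit hU₀) (hunit hV₀)]

theorem exists_transferFunction_eq_mul_mul [Finite κ] (S : Realization ι r)
    (U : Matrix κ ι ℂ[X]) (V : Matrix ι κ ℂ[X]) :
    ∃ T : Realization κ r, T.transferFunction = U.map (algebraMap ℂ[X] (RatFunc ℂ)) *
      S.transferFunction * V.map (algebraMap ℂ[X] (RatFunc ℂ)) := by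
  obtain ⟨Q, C, hC⟩ := exists_eq_mul_pencil_add (isUnit_E S) S.A (U * S.C.map Polynomial.C)
  obtain ⟨Q', B, hB⟩ := exists_eq_pencil_mul_add (isUnit_E S) S.A (S.B.map Polynomial.C * V)
  let T : Realization κ r :=
    { P := (U * S.P + Q * S.B.map Polynomial.C) * V + C.map Polynomial.C * Q'
      C, E := S.E, A := S.A, B, nonsingular := S.nonsingular }
  refine ⟨T, transferFunction_eq_mul_mul (Q := Q) (Q' := Q') isUnit_one isUnit_one ?_⟩
  rw [Matrix.map_one _ (map_zero Polynomial.C) (map_one Polynomial.C), Realization.systemMatrix,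
    Realization.systemMatrix, fromBlocks_multiply, fromBlocks_multiply,
    ← neg_sub ((X : ℂ[X]) • _), hC]
  simp only [T, Matrix.mul_neg, Matrix.neg_mul, Matrix.zero_mul, Matrix.mul_zero, Matrix.one_mul,
    Matrix.mul_one, hB, zero_add, add_neg_cancel_comm]

theorem isMinimal_of_systemMatrix_eq [Finite κ] {S : Realization ι r} {T : Realization κ r}
    {U : Matrix κ ι ℂ[X]} {V : Matrix ι κ ℂ[X]} {U₀ V₀ : Matrix (Fin r) (Fin r) ℂ}
    (hU₀ : IsUnit U₀) (hV₀ : IsUnit V₀)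
    (h : fromBlocks U 0 0 (U₀.map Polynomial.C) * S.systemMatrix *
      fromBlocks V 0 0 (V₀.map Polynomial.C) = T.systemMatrix) (hT : T.IsMinimal) :
    S.IsMinimal := by
  intro r' S' hS'
  obtain ⟨T', hT'⟩ := exists_transferFunction_eq_mul_mul S' U V
  exact hT r' T' (by rw [hT', hS', transferFunction_eq_mul_mul hU₀ hV₀ h])

end Realization

section BlockDiagonal

theorem fromBlocks_diagonal_mul {ι ι' ι'' κ κ' κ'' R : Type*} [Fintype ι'] [Fintype κ']
    [NonUnitalNonAssocSemiring R] (Φ : Matrix ι ι' R) (Ψ : Matrix κ κ' R) (Φ' : Matrix ι' ι'' R)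
    (Ψ' : Matrix κ' κ'' R) :
    fromBlocks Φ 0 0 Ψ * fromBlocks Φ' 0 0 Ψ' = fromBlocks (Φ * Φ') 0 0 (Ψ * Ψ') := by
  rw [fromBlocks_multiply, Matrix.mul_zero, Matrix.mul_zero, Matrix.zero_mul, Matrix.zero_mul,
    Matrix.zero_mul, Matrix.mul_zero, add_zero, add_zero, add_zero, zero_add]

theorem fromBlocks_diagonal_map {ι ι' κ κ' R R' : Type*} [NonAssocSemiring R]
    [NonAssocSemiring R'] (f : R →+* R') (Φ : Matrix ι ι' R) (Ψ : Matrix κ κ' R) :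
    (fromBlocks Φ 0 0 Ψ).map f = fromBlocks (Φ.map f) 0 0 (Ψ.map f) := by
  rw [fromBlocks_map, Matrix.map_zero _ (map_zero f), Matrix.map_zero _ (map_zero f)]

variable {ι κ R : Type*} [Fintype ι] [DecidableEq ι] [Fintype κ] [DecidableEq κ] [Semiring R]

variable (ι κ R) in
/-- The invertible matrices `diag(Φ, Ψ)`, partitioned conformably with a system matrix. -/
def invertibleBlockDiagonal : Submonoid (Matrix (ι ⊕ κ) (ι ⊕ κ) R) where
  carrier := {N | ∃ Φ Ψ, IsUnit Φ ∧ IsUnit Ψ ∧ N = fromBlocks Φ 0 0 Ψ}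
  one_mem' := ⟨1, 1, isUnit_one, isUnit_one, fromBlocks_one.symm⟩
  mul_mem' := by
    rintro _ _ ⟨Φ, Ψ, hΦ, hΨ, rfl⟩ ⟨Φ', Ψ', hΦ', hΨ', rfl⟩
    exact ⟨Φ * Φ', Ψ * Ψ', hΦ.mul hΦ', hΨ.mul hΨ', fromBlocks_diagonal_mul _ _ _ _⟩

theorem fromBlocks_mem_invertibleBlockDiagonal {Φ : Matrix ι ι R} {Ψ : Matrix κ κ R}
    (hΦ : IsUnit Φ) (hΨ : IsUnit Ψ) : fromBlocks Φ 0 0 Ψ ∈ invertibleBlockDiagonal ι κ R :=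
  ⟨Φ, Ψ, hΦ, hΨ, rfl⟩

theorem isUnit_of_mem_invertibleBlockDiagonal {R : Type*} [CommRing R]
    {N : Matrix (ι ⊕ κ) (ι ⊕ κ) R} (hN : N ∈ invertibleBlockDiagonal ι κ R) : IsUnit N := by
  obtain ⟨Φ, Ψ, hΦ, hΨ, rfl⟩ := hN
  exact isUnit_fromBlocks_zero₂₁.2 ⟨hΦ, hΨ⟩

theorem inv_mem_invertibleBlockDiagonal {R : Type*} [CommRing R] {N : Matrix (ι ⊕ κ) (ι ⊕ κ) R}
    (hN : N ∈ invertibleBlockDiagonal ι κ R) : N⁻¹ ∈ invertibleBlockDiagonal ι κ R := by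
  obtain ⟨_, _, ⟨Φ, rfl⟩, ⟨Ψ, rfl⟩, rfl⟩ := hN
  rw [inv_eq_left_inv (B := fromBlocks Φ⁻¹.val 0 0 Ψ⁻¹.val)]
  · exact fromBlocks_mem_invertibleBlockDiagonal Φ⁻¹.isUnit Ψ⁻¹.isUnit
  · rw [fromBlocks_diagonal_mul, Units.inv_mul, Units.inv_mul, fromBlocks_one]

end BlockDiagonal

section StrictEquivalence

variable {r : ℕ}

theorem exists_systemMatrix_eq_mul_mul {ι : Type*} [Fintype ι] (T : Realization ι r)
    (Φ₁ Φ₂ : Matrix ι ι ℂ) {Ψ₁ Ψ₂ : Matrix (Fin r) (Fin r) ℂ} (hΨ₁ : IsUnit Ψ₁) (hΨ₂ : IsUnit Ψ₂) :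
    ∃ T' : Realization ι r, T'.P = Φ₁.map Polynomial.C * T.P * Φ₂.map Polynomial.C ∧
      T'.systemMatrix = (fromBlocks Φ₁ 0 0 Ψ₁).map Polynomial.C * T.systemMatrix *
        (fromBlocks Φ₂ 0 0 Ψ₂).map Polynomial.C := by
  refine ⟨{ P := Φ₁.map Polynomial.C * T.P * Φ₂.map Polynomial.C, C := Φ₁ * T.C * Ψ₂,
            E := Ψ₁ * T.E * Ψ₂, A := Ψ₁ * T.A * Ψ₂, B := Ψ₁ * T.B * Φ₂,
            nonsingular := (isUnit_iff_isUnit_det _).1 ((hΨ₁.mul (isUnit_E T)).mul hΨ₂) },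
    rfl, ?_⟩
  simp only [Realization.systemMatrix, fromBlocks_diagonal_map, fromBlocks_multiply,
    Matrix.map_mul, Matrix.mul_sub, Matrix.sub_mul, Matrix.mul_smul, Matrix.smul_mul,
    Matrix.zero_mul, Matrix.mul_zero, smul_zero, sub_zero, zero_add, add_zero]

theorem inv_mul_map_mul_mul_map_mul_inv {ι κ R R' : Type*} [Fintype ι] [DecidableEq ι]
    [Fintype κ] [DecidableEq κ] [Semiring R] [Semiring R'] (f : R →+* R')
    (Φ₁ Φ₂ : (Matrix ι ι R)ˣ) (Ψ₁ Ψ₂ : (Matrix κ κ R)ˣ) (N : Matrix (ι ⊕ κ) (ι ⊕ κ) R') :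
    fromBlocks (Φ₁⁻¹.val.map f) 0 0 (Ψ₁⁻¹.val.map f) *
      ((fromBlocks Φ₁.val 0 0 Ψ₁.val).map f * N * (fromBlocks Φ₂.val 0 0 Ψ₂.val).map f) *
      fromBlocks (Φ₂⁻¹.val.map f) 0 0 (Ψ₂⁻¹.val.map f) = N := by
  rw [← fromBlocks_diagonal_map, ← fromBlocks_diagonal_map, ← Matrix.mul_assoc,
    ← Matrix.mul_assoc, ← Matrix.map_mul, Matrix.mul_assoc, ← Matrix.map_mul,
    fromBlocks_diagonal_mul, fromBlocks_diagonal_mul, Units.inv_mul, Units.inv_mul, Units.mul_inv,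
    Units.mul_inv, fromBlocks_one, Matrix.map_one _ (map_zero f) (map_one f), Matrix.one_mul,
    Matrix.mul_one]

theorem IsRosenbrockStrongLinearization.mul_mul {n m : ℕ}
    {G : Matrix (Fin n) (Fin n) (RatFunc ℂ)} {S : Realization (Fin n) r}
    {L : Matrix ((Fin m × Fin n) ⊕ Fin r) ((Fin m × Fin n) ⊕ Fin r) ℂ[X]}
    {N₁ N₂ : Matrix ((Fin m × Fin n) ⊕ Fin r) ((Fin m × Fin n) ⊕ Fin r) ℂ}
    (hL : IsRosenbrockStrongLinearization m G S L)
    (hN₁ : N₁ ∈ invertibleBlockDiagonal (Fin m × Fin n) (Fin r) ℂ)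
    (hN₂ : N₂ ∈ invertibleBlockDiagonal (Fin m × Fin n) (Fin r) ℂ) :
    IsRosenbrockStrongLinearization m G S
      (N₁.map Polynomial.C * L * N₂.map Polynomial.C) := by
  obtain ⟨T, ⟨𝒳, 𝒴, hP⟩, rfl, hmin, ⟨U, V, U₀, V₀, hU, hV, hU₀, hV₀, ha⟩, Oℓ, Oᵣ, hOℓ, hOᵣ, hb⟩ :=
    hL
  obtain ⟨_, _, ⟨Φ₁, rfl⟩, ⟨Ψ₁, rfl⟩, rfl⟩ := hN₁
  obtain ⟨_, _, ⟨Φ₂, rfl⟩, ⟨Ψ₂, rfl⟩, rfl⟩ := hN₂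
  obtain ⟨T', hT'P, hT'⟩ := exists_systemMatrix_eq_mul_mul T Φ₁ Φ₂ Ψ₁.isUnit Ψ₂.isUnit
  have hT := inv_mul_map_mul_mul_map_mul_inv Polynomial.C Φ₁ Φ₂ Ψ₁ Ψ₂ T.systemMatrix
  rw [← hT'] at hT
  rw [isUnimodular_iff] at hU hV
  rw [transferFunction_eq_mul_mul Ψ₁⁻¹.isUnit Ψ₂⁻¹.isUnit hT, map_C_map_algebraMap,
    map_C_map_algebraMap] at hb
  rw [← hT']
  refine ⟨T', ⟨Φ₁ * 𝒳 * Φ₂, Φ₁ * 𝒴 * Φ₂, ?_⟩, rfl,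
    isMinimal_of_systemMatrix_eq Ψ₁⁻¹.isUnit Ψ₂⁻¹.isUnit hT hmin,
    ⟨U * Φ₁⁻¹.val.map Polynomial.C, Φ₂⁻¹.val.map Polynomial.C * V, U₀ * Ψ₁⁻¹.val, Ψ₂⁻¹.val * V₀,
      ?_, ?_, ?_, ?_, ?_⟩,
    Oℓ * Φ₁⁻¹.val.map RatFunc.C, Φ₂⁻¹.val.map RatFunc.C * Oᵣ,
    hOℓ.mul (isBiproper_map_C Φ₁⁻¹.isUnit), (isBiproper_map_C Φ₂⁻¹.isUnit).mul hOᵣ, ?_⟩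
  · simp only [hT'P, hP, Matrix.map_mul, Matrix.mul_sub, Matrix.sub_mul, Matrix.mul_smul,
      Matrix.smul_mul]
  · exact isUnimodular_iff.2 (hU.mul (Φ₁⁻¹.isUnit.map (Polynomial.C (R := ℂ)).mapMatrix))
  · exact isUnimodular_iff.2 ((Φ₂⁻¹.isUnit.map (Polynomial.C (R := ℂ)).mapMatrix).mul hV)
  · rw [det_mul]
    exact hU₀.mul ((isUnit_iff_isUnit_det _).1 Ψ₁⁻¹.isUnit)
  · rw [det_mul]
    exact ((isUnit_iff_isUnit_det _).1 Ψ₂⁻¹.isUnit).mul hV₀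
  · rw [← ha, ← hT]
    simp only [← fromBlocks_diagonal_mul, Matrix.map_mul, Matrix.mul_assoc]
  · simpa only [Matrix.mul_smul, Matrix.smul_mul, Matrix.mul_assoc] using hb

end StrictEquivalence

section FiedlerMatrices

variable {n r : ℕ} (S : Realization (Fin n) r)

theorem fiedler_zero (m : ℕ) : fiedler m S 0 = fiedlerZero m S :=
  if_pos rfl

theorem fiedler_neg_top {m : ℕ} (hm : 1 ≤ m) : fiedler m S (-m) = fiedlerNegTop m S := by
  rw [fiedler, if_neg (by omega), if_pos rfl]

theorem fiedler_top {m : ℕ} (hm : 1 ≤ m) : fiedler m S m = (fiedlerNegTop m S)⁻¹ := by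
  rw [fiedler, if_neg (by omega), if_neg (by omega), if_pos rfl]

theorem fiedler_of_lt {m i : ℕ} (hi : 1 ≤ i) (him : i < m) :
    fiedler m S i = fiedlerPos m S i := by
  rw [fiedler, if_neg (by omega), if_neg (by omega), if_neg (by omega), if_pos (by omega),
    Int.natAbs_natCast]

theorem fiedler_neg_of_lt {m i : ℕ} (hi : 1 ≤ i) (him : i < m) :
    fiedler m S (-i) = (fiedlerPos m S i)⁻¹ := by
  rw [fiedler, if_neg (by omega), if_neg (by omega), if_neg (by omega), if_neg (by omega),
    Int.natAbs_neg, Int.natAbs_natCast]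

variable {M : ℕ}

theorem fiedlerNegTop_eq : fiedlerNegTop (M + 1) S =
    fromBlocks (flatten M (Fin n) ℂ (corner (blockPos M M) (S.coeff (M + 1)))) 0 0 (-S.E) := by
  rw [fiedlerNegTop, firstDiag_eq_flatten]

theorem fiedlerPos_eq {i : ℕ} (hi : 1 ≤ i) (hiM : i ≤ M) : fiedlerPos (M + 1) S i =
    fromBlocks (flatten M (Fin n) ℂ (swapBlock (blockPos M (i - 1)) (blockPos M i) (-S.coeff i)))
      0 0 1 := by
  rw [fiedlerPos, elementary_eq_flatten hi hiM]

theorem blockPos_pred_ne {i : ℕ} (hi : 1 ≤ i) (hiM : i ≤ M) :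
    blockPos M i ≠ blockPos M (i - 1) := fun h => by
  have := (bijOn_blockPos M).injOn (Set.mem_Iic.2 hiM) (Set.mem_Iic.2 (by omega)) h
  omega

theorem fiedler_neg_eq {i : ℕ} (hi : 1 ≤ i) (hiM : i ≤ M) : fiedler (M + 1) S (-i) =
    fromBlocks (flatten M (Fin n) ℂ (swapBlock (blockPos M i) (blockPos M (i - 1)) (S.coeff i)))
      0 0 1 := by
  rw [fiedler_neg_of_lt S hi (Nat.lt_succ_of_le hiM), fiedlerPos_eq S hi hiM]
  refine inv_eq_left_inv ?_
  rw [fromBlocks_diagonal_mul, ← map_mul, swapBlock_mul_swapBlock (blockPos_pred_ne hi hiM),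
    map_one, Matrix.one_mul, fromBlocks_one]

theorem fiedler_neg_mem_invertibleBlockDiagonal {i : ℕ} (hi : 1 ≤ i) (hiM : i ≤ M + 1)
    (hinv : i = M + 1 → IsUnit (S.coeff (M + 1)).det) :
    fiedler (M + 1) S (-i) ∈ invertibleBlockDiagonal (Fin (M + 1) × Fin n) (Fin r) ℂ := by
  obtain hlt | rfl := hiM.lt_or_eq
  · rw [fiedler_neg_eq S hi (Nat.le_of_lt_succ hlt)]
    exact fromBlocks_mem_invertibleBlockDiagonal
      ((isUnit_swapBlock (blockPos_pred_ne hi (Nat.le_of_lt_succ hlt)) _).map _) isUnit_one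
  · rw [fiedler_neg_top S hi, fiedlerNegTop_eq]
    exact fromBlocks_mem_invertibleBlockDiagonal
      ((isUnit_corner ((isUnit_iff_isUnit_det _).2 (hinv rfl))).map _) (isUnit_E S).neg

theorem fiedler_mul_fiedler_neg {i : ℕ} (hi : 1 ≤ i) (hiM : i ≤ M + 1)
    (hinv : i = M + 1 → IsUnit (S.coeff (M + 1)).det) :
    fiedler (M + 1) S i * fiedler (M + 1) S (-i) = 1 := by
  have hunit := (isUnit_iff_isUnit_det _).1 (isUnit_of_mem_invertibleBlockDiagonal
    (fiedler_neg_mem_invertibleBlockDiagonal S hi hiM hinv))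
  obtain hlt | rfl := hiM.lt_or_eq
  · rw [fiedler_neg_of_lt S hi hlt] at hunit ⊢
    rw [fiedler_of_lt S hi hlt, mul_nonsing_inv _ (isUnit_nonsing_inv_det_iff.1 hunit)]
  · rw [fiedler_neg_top S hi] at hunit ⊢
    rw [fiedler_top S hi, nonsing_inv_mul _ hunit]

theorem fiedler_mem_invertibleBlockDiagonal {i : ℕ} (hi : 1 ≤ i) (hiM : i ≤ M + 1)
    (hinv : i = M + 1 → IsUnit (S.coeff (M + 1)).det) :
    fiedler (M + 1) S i ∈ invertibleBlockDiagonal (Fin (M + 1) × Fin n) (Fin r) ℂ := by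
  rw [← inv_eq_left_inv (fiedler_mul_fiedler_neg S hi hiM hinv)]
  exact inv_mem_invertibleBlockDiagonal (fiedler_neg_mem_invertibleBlockDiagonal S hi hiM hinv)

theorem fiedlerProd_neg {α : List ℕ} (hα : ∀ i ∈ α, 1 ≤ i ∧ i ≤ M) :
    (α.map fun i : ℕ => fiedler (M + 1) S (-i)).prod =
      fromBlocks (flatten M (Fin n) ℂ (swapProd (blockPos M) S.coeff α)) 0 0 1 := by
  induction α with
  | nil => rw [List.map_nil, List.prod_nil, swapProd, List.map_nil, List.prod_nil, map_one,
      fromBlocks_one]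
  | cons i α ih =>
    rw [List.forall_mem_cons] at hα
    rw [List.map_cons, List.prod_cons, ih hα.2, fiedler_neg_eq S hα.1.1 hα.1.2,
      fromBlocks_diagonal_mul, ← map_mul, Matrix.mul_one, swapProd_cons]

theorem gfp_eq (m : ℕ) (ω₀ ω₁ : List ℕ) : gfp m S ω₀ ω₁ =
    (X : ℂ[X]) • ((ω₁.map fun i : ℕ => fiedler m S (-i)).prod).map Polynomial.C -
      ((ω₀.map fun i : ℕ => fiedler m S i).prod).map Polynomial.C := by
  -- In `gfp` the whole list `ω₁` is coerced to `List ℤ` by a monadic map.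
  simp only [gfp, fiedlerProd, bind_pure_comp, List.map_eq_map, List.map_map, Function.comp_def]

theorem gfp_append_cons_zero {m : ℕ} {σ₁ σ₂ : List ℕ} (ω₁ : List ℕ)
    (h₁ : ∀ i ∈ σ₁, fiedler m S i * fiedler m S (-i) = 1)
    (h₂ : ∀ i ∈ σ₂, fiedler m S i * fiedler m S (-i) = 1) :
    gfp m S (σ₁ ++ 0 :: σ₂) ω₁ =
      ((σ₁.map fun i : ℕ => fiedler m S i).prod).map Polynomial.C *
        gfp m S [0] (σ₁.reverse ++ ω₁ ++ σ₂.reverse) *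
          ((σ₂.map fun i : ℕ => fiedler m S i).prod).map Polynomial.C := by
  have e₁ := prod_map_mul_prod_map_reverse h₁
  have e₂ := prod_map_mul_prod_map_reverse (s := σ₂.reverse)
    fun i hi => mul_eq_one_comm.1 (h₂ i (List.mem_reverse.1 hi))
  rw [List.reverse_reverse] at e₂
  have e : (σ₁.map fun i : ℕ => fiedler m S i).prod *
      ((σ₁.reverse ++ ω₁ ++ σ₂.reverse).map fun i : ℕ => fiedler m S (-i)).prod *
      (σ₂.map fun i : ℕ => fiedler m S i).prod =
      (ω₁.map fun i : ℕ => fiedler m S (-i)).prod := by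
    rw [List.map_append, List.map_append, List.prod_append, List.prod_append, Matrix.mul_assoc,
      Matrix.mul_assoc, e₂, Matrix.mul_one, ← Matrix.mul_assoc, e₁, Matrix.one_mul]
  rw [gfp_eq, gfp_eq, Matrix.mul_sub, Matrix.sub_mul, Matrix.mul_smul, Matrix.smul_mul,
    ← Matrix.map_mul, ← Matrix.map_mul, e, ← Matrix.map_mul, ← Matrix.map_mul]
  simp only [List.map_append, List.map_cons, List.map_nil, List.prod_append, List.prod_cons,
    List.prod_nil, mul_one, mul_assoc]

end FiedlerMatrices

section PencilRealization

variable {ι : Type*} {r M : ℕ}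

theorem P_eq_sum_coeff (S : Realization ι r) {m : ℕ} (hdeg : ∀ a b, (S.P a b).natDegree ≤ m) :
    S.P = ∑ j ∈ range (m + 1), (X : ℂ[X]) ^ j • (S.coeff j).map Polynomial.C := by
  ext1 a b
  rw [Matrix.sum_apply, as_sum_range_C_mul_X_pow' (S.P a b) (Nat.lt_succ_of_le (hdeg a b))]
  simp only [Matrix.smul_apply, map_apply, Realization.coeff, smul_eq_mul, mul_comm]

/-- `A_0 + C (λ E - A)⁻¹ B`, the proper part of the transfer function of `S`, as a matrix of
proper rational functions. -/
noncomputable def properPart (S : Realization ι r) : Matrix ι ι properSubring :=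
  (S.coeff 0).map properConst +
    S.C.map properConst * (properXInv • (properPencil S.E S.A)⁻¹) * S.B.map properConst

theorem map_properPart (S : Realization ι r) : (properPart S).map properSubring.subtype =
    (S.coeff 0).map RatFunc.C +
      S.C.map RatFunc.C * ((RatFunc.X : RatFunc ℂ) • S.E.map RatFunc.C - S.A.map RatFunc.C)⁻¹ *
        S.B.map RatFunc.C := by
  rw [← map_properPencil_inv (isUnit_E S), properPart,
    Matrix.map_add _ (map_add properSubring.subtype), Matrix.map_mul, Matrix.map_mul]
  rfl

theorem transferFunction_eq_sum_add_properPart (S : Realization ι r) {m : ℕ}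
    (hdeg : ∀ a b, (S.P a b).natDegree ≤ m) :
    S.transferFunction =
      ∑ j ∈ range m, (RatFunc.X : RatFunc ℂ) ^ (j + 1) • (S.coeff (j + 1)).map RatFunc.C +
        (properPart S).map properSubring.subtype := by
  have hP : S.P.map (algebraMap ℂ[X] (RatFunc ℂ)) =
      ∑ j ∈ range (m + 1), (RatFunc.X : RatFunc ℂ) ^ j • (S.coeff j).map RatFunc.C := by
    conv_lhs => rw [P_eq_sum_coeff S hdeg]
    ext a b
    simp only [map_apply, Matrix.sum_apply, Matrix.smul_apply, smul_eq_mul, map_sum, map_mul,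
      map_pow, RatFunc.algebraMap_X, RatFunc.algebraMap_C]
  rw [Realization.transferFunction, hP, sum_range_succ', pow_zero, one_smul, add_assoc,
    map_properPart]

theorem map_sum_coeff_add_properPart (S : Realization ι r) {m : ℕ}
    (hdeg : ∀ a b, (S.P a b).natDegree ≤ m) :
    (∑ j ∈ range m, properXInv ^ j • (S.coeff (m - j)).map properConst +
      properXInv ^ m • properPart S).map properSubring.subtype =
    ((RatFunc.X : RatFunc ℂ) ^ m)⁻¹ • S.transferFunction := by
  have hmap : (∑ j ∈ range m, properXInv ^ j • (S.coeff (m - j)).map properConst +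
      properXInv ^ m • properPart S).map properSubring.subtype =
      ∑ j ∈ range m, (RatFunc.X : RatFunc ℂ)⁻¹ ^ j • (S.coeff (m - j)).map RatFunc.C +
        (RatFunc.X : RatFunc ℂ)⁻¹ ^ m • (properPart S).map properSubring.subtype := by
    ext a b
    simp only [map_apply, Matrix.add_apply, Matrix.sum_apply, Matrix.smul_apply, smul_eq_mul,
      map_add, map_sum, map_mul, map_pow]
    rfl
  rw [hmap, transferFunction_eq_sum_add_properPart S hdeg, smul_add, inv_pow, smul_sum,
    ← sum_range_reflect]
  congr 1
  refine sum_congr rfl fun j hj => ?_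
  obtain ⟨k, rfl⟩ : ∃ k, m = j + 1 + k := Nat.exists_eq_add_of_le (mem_range.1 hj)
  rw [smul_smul, show j + 1 + k - 1 - j = k by omega, show j + 1 + k - k = j + 1 by omega]
  congr 1
  rw [pow_add _ (j + 1) k, mul_inv, mul_right_comm,
    inv_mul_cancel₀ (pow_ne_zero _ RatFunc.X_ne_zero), one_mul, inv_pow]

variable [DecidableEq ι]

/-- The realization whose system matrix is `λ diag(W, -E) - M_0`, with the Fiedler matrix `M_0` of
`S`. -/
noncomputable def pencilRealization (m : ℕ) (S : Realization ι r)
    (W : Matrix (Fin m × ι) (Fin m × ι) ℂ) : Realization (Fin m × ι) r where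
  P := (X : ℂ[X]) • W.map Polynomial.C - (lastDiag m (-S.coeff 0)).map Polynomial.C
  C := lastCol m S.C
  E := S.E
  A := S.A
  B := lastRow m S.B
  nonsingular := S.nonsingular

theorem systemMatrix_pencilRealization {n m : ℕ} (S : Realization (Fin n) r)
    (W : Matrix (Fin m × Fin n) (Fin m × Fin n) ℂ) :
    (pencilRealization m S W).systemMatrix =
      (X : ℂ[X]) • (fromBlocks W 0 0 (-S.E)).map Polynomial.C -
        (fiedlerZero m S).map Polynomial.C := by
  ext1 (i | i) (j | j)
  · rfl
  all_goals
    simp only [Realization.systemMatrix, pencilRealization, fiedlerZero, fromBlocks_map,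
      Matrix.sub_apply, Matrix.smul_apply, map_apply, Matrix.neg_apply, Matrix.zero_apply,
      fromBlocks_apply₁₂, fromBlocks_apply₂₁, fromBlocks_apply₂₂, map_neg, map_zero, smul_neg,
      smul_zero, sub_neg_eq_add, neg_add_eq_sub, zero_add]

theorem transferFunction_pencilRealization [Finite ι] (S : Realization ι r)
    (W : Matrix (Fin (M + 1) × ι) (Fin (M + 1) × ι) ℂ) :
    (pencilRealization (M + 1) S W).transferFunction =
      (RatFunc.X : RatFunc ℂ) • W.map RatFunc.C -
        lastDiag (M + 1) (-(properPart S).map properSubring.subtype) := by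
  cases nonempty_fintype ι
  simp only [Realization.transferFunction, pencilRealization]
  rw [map_algebraMap_pencil, map_lastDiag, Matrix.map_neg _ (map_neg RatFunc.C), map_lastCol,
    map_lastRow, lastCol_eq_mul (S.C.map _), lastRow_eq_mul (S.B.map _), map_properPart, neg_add,
    lastDiag_add, lastCol_eq_mul (-_)]
  simp only [Matrix.mul_neg, Matrix.neg_mul, ← Matrix.mul_assoc]
  abel

variable [Fintype ι]

theorem exists_isUnit_mul_systemMatrix_pencilRealization_mul (S : Realization ι r)
    (hdeg : ∀ a b, (S.P a b).natDegree ≤ M + 1) {α β : List ℕ}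
    (hαβ : (α ++ β).Perm (List.range' 1 M)) :
    ∃ U V : Matrix (Fin (M + 1) × ι) (Fin (M + 1) × ι) ℂ[X], IsUnit U ∧ IsUnit V ∧
      fromBlocks U 0 0 1 *
        (pencilRealization (M + 1) S (flatten M ι ℂ (fiedlerLeading (blockPos M) S.coeff M
          (S.coeff (M + 1)) α β))).systemMatrix * fromBlocks V 0 0 1 =
      padIdentity (M + 1) S.systemMatrix := by
  obtain ⟨U, V, hU, hV, hU', hV', h⟩ := cornerEquivalent_corner_sum (X : ℂ[X])
    (fun j => (S.coeff j).map Polynomial.C) (bijOn_blockPos M).injOn hαβ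
  refine ⟨flatten M ι _ U, flatten M ι _ V, hU.map _, hV.map _, ?_⟩
  have hP : flatten M ι _ U * (pencilRealization (M + 1) S (flatten M ι ℂ
      (fiedlerLeading (blockPos M) S.coeff M (S.coeff (M + 1)) α β))).P * flatten M ι _ V =
      lastDiag (M + 1) S.P := by
    rw [pencilRealization, flatten_map, map_fiedlerLeading, map_lastDiag,
      Matrix.map_neg _ (map_neg Polynomial.C), lastDiag_eq_flatten, ← flatten_smul, ← map_sub,
      ← map_mul, ← map_mul, lastDiag_eq_flatten, P_eq_sum_coeff S hdeg]
    exact congrArg _ h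
  simp only [Realization.systemMatrix, fromBlocks_multiply, hP, padIdentity, Matrix.zero_mul,
    Matrix.mul_zero, Matrix.mul_one, Matrix.one_mul, zero_add, add_zero]
  simp only [pencilRealization, map_lastCol, map_lastRow, flatten_mul_lastCol hU',
    lastRow_mul_flatten hV', toBlocks_fromBlocks₁₁, toBlocks_fromBlocks₁₂,
    toBlocks_fromBlocks₂₁, toBlocks_fromBlocks₂₂]

theorem isMinimal_of_eq_padIdentity {S : Realization ι r} {T : Realization (Fin (M + 1) × ι) r}
    {U V : Matrix (Fin (M + 1) × ι) (Fin (M + 1) × ι) ℂ[X]}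
    (h : fromBlocks U 0 0 1 * T.systemMatrix * fromBlocks V 0 0 1 =
      padIdentity (M + 1) S.systemMatrix) (hS : S.IsMinimal) : T.IsMinimal := by
  refine isMinimal_of_systemMatrix_eq (U := lastRow (M + 1) (1 : Matrix ι ι ℂ[X]) * U)
    (V := V * lastCol (M + 1) (1 : Matrix ι ι ℂ[X])) isUnit_one isUnit_one ?_ hS
  have hU := fromBlocks_diagonal_mul (lastRow (M + 1) (1 : Matrix ι ι ℂ[X]))
    (1 : Matrix (Fin r) (Fin r) ℂ[X]) U (1 : Matrix (Fin r) (Fin r) ℂ[X])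
  have hV := fromBlocks_diagonal_mul V (1 : Matrix (Fin r) (Fin r) ℂ[X])
    (lastCol (M + 1) (1 : Matrix ι ι ℂ[X])) (1 : Matrix (Fin r) (Fin r) ℂ[X])
  have hpad : fromBlocks (lastRow (M + 1) (1 : Matrix ι ι ℂ[X])) 0 0
      (1 : Matrix (Fin r) (Fin r) ℂ[X]) * padIdentity (M + 1) S.systemMatrix *
        fromBlocks (lastCol (M + 1) (1 : Matrix ι ι ℂ[X])) 0 0
          (1 : Matrix (Fin r) (Fin r) ℂ[X]) = S.systemMatrix := by
    simp only [padIdentity, fromBlocks_multiply, Matrix.zero_mul, Matrix.mul_zero, Matrix.one_mul,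
      Matrix.mul_one, add_zero, zero_add, lastRow_mul_lastDiag_mul_lastCol, lastRow_mul_lastCol,
      fromBlocks_toBlocks]
  rw [Matrix.one_mul] at hU hV
  rw [Matrix.map_one _ (map_zero _) (map_one _), ← hU, ← hV, ← hpad, ← h]
  simp only [Matrix.mul_assoc]

theorem exists_isBiproper_mul_transferFunction_pencilRealization_mul (S : Realization ι r)
    (hdeg : ∀ a b, (S.P a b).natDegree ≤ M + 1) {α β : List ℕ}
    (hαβ : (α ++ β).Perm (List.range' 1 M)) :
    ∃ Oℓ Oᵣ : Matrix (Fin (M + 1) × ι) (Fin (M + 1) × ι) (RatFunc ℂ),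
      IsBiproper Oℓ ∧ IsBiproper Oᵣ ∧
      Oℓ * ((RatFunc.X : RatFunc ℂ)⁻¹ • (pencilRealization (M + 1) S (flatten M ι ℂ
        (fiedlerLeading (blockPos M) S.coeff M (S.coeff (M + 1)) α β))).transferFunction) * Oᵣ =
      lastDiag (M + 1) (((RatFunc.X : RatFunc ℂ) ^ (M + 1))⁻¹ • S.transferFunction) := by
  obtain ⟨U, V, hU, hV, h⟩ := exists_isUnit_mul_reversed_mul properXInv (bijOn_blockPos M)
    (fun j => (S.coeff j).map properConst) (properPart S) hαβ
  refine ⟨_, _, isBiproper_iff.2 ⟨_, hU.map (flatten M ι properSubring), rfl⟩,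
    isBiproper_iff.2 ⟨_, hV.map (flatten M ι properSubring), rfl⟩, ?_⟩
  have hT : (RatFunc.X : RatFunc ℂ)⁻¹ • (pencilRealization (M + 1) S (flatten M ι ℂ
      (fiedlerLeading (blockPos M) S.coeff M (S.coeff (M + 1)) α β))).transferFunction =
      (flatten M ι properSubring (fiedlerLeading (blockPos M)
        (fun j => (S.coeff j).map properConst) M ((S.coeff (M + 1)).map properConst) α β -
          properXInv • corner (blockPos M 0) (-properPart S))).map properSubring.subtype := by
    have hW := map_fiedlerLeading properConst.mapMatrix (blockPos M) S.coeff M (S.coeff (M + 1)) α β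
    simp only [RingHom.mapMatrix_apply] at hW
    rw [← hW, map_sub, flatten_smul, ← lastDiag_eq_flatten, transferFunction_pencilRealization,
      Matrix.map_sub _ (map_sub properSubring.subtype), smul_sub,
      inv_smul_smul₀ RatFunc.X_ne_zero, ← Matrix.map_neg _ (map_neg properSubring.subtype),
      ← map_lastDiag]
    rfl
  rw [hT, ← Matrix.map_mul, ← Matrix.map_mul, ← map_mul, ← map_mul, h, ← lastDiag_eq_flatten,
    map_lastDiag, map_sum_coeff_add_properPart S hdeg]

end PencilRealization

section GeneralizedFiedlerPencil

variable {n r M : ℕ} (S : Realization (Fin n) r)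

theorem gfp_singleton_zero_eq {α β : List ℕ} (hα : ∀ i ∈ α, 1 ≤ i ∧ i ≤ M)
    (hβ : ∀ i ∈ β, 1 ≤ i ∧ i ≤ M) :
    gfp (M + 1) S [0] (α ++ (M + 1) :: β) =
      (pencilRealization (M + 1) S (flatten M (Fin n) ℂ (fiedlerLeading (blockPos M) S.coeff M
        (S.coeff (M + 1)) α β))).systemMatrix := by
  have hleading : ((α ++ (M + 1) :: β).map fun i : ℕ => fiedler (M + 1) S (-i)).prod =
      fromBlocks (flatten M (Fin n) ℂ (fiedlerLeading (blockPos M) S.coeff M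
        (S.coeff (M + 1)) α β)) 0 0 (-S.E) := by
    rw [List.map_append, List.map_cons, List.prod_append, List.prod_cons, fiedlerProd_neg S hα,
      fiedlerProd_neg S hβ, fiedler_neg_top S (Nat.le_add_left 1 M), fiedlerNegTop_eq,
      fromBlocks_diagonal_mul, fromBlocks_diagonal_mul, Matrix.one_mul, Matrix.mul_one,
      fiedlerLeading, truncDiag_eq_corner (bijOn_blockPos M), map_mul, map_mul, Matrix.mul_assoc]
  rw [gfp_eq, hleading, systemMatrix_pencilRealization, List.map_singleton, List.prod_singleton,
    Nat.cast_zero, fiedler_zero]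

theorem isRosenbrockStrongLinearization_gfp_singleton_zero
    (hdeg : ∀ a b, (S.P a b).natDegree ≤ M + 1) (hS : S.IsMinimal) {τ : List ℕ}
    (hτ : τ.Perm (List.range' 1 (M + 1))) :
    IsRosenbrockStrongLinearization (M + 1) S.transferFunction S (gfp (M + 1) S [0] τ) := by
  obtain ⟨α, β, rfl, hαβ⟩ := exists_append_cons_of_perm_range'_succ hτ
  rw [gfp_singleton_zero_eq S
    (fun j hj => mem_bounds_of_perm_range' hαβ (List.mem_append_left β hj))
    (fun j hj => mem_bounds_of_perm_range' hαβ (List.mem_append_right α hj))]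
  set W := flatten M (Fin n) ℂ (fiedlerLeading (blockPos M) S.coeff M (S.coeff (M + 1)) α β)
  obtain ⟨U, V, hU, hV, hUV⟩ :=
    exists_isUnit_mul_systemMatrix_pencilRealization_mul S hdeg hαβ
  refine ⟨pencilRealization (M + 1) S W, ⟨-lastDiag (M + 1) (-S.coeff 0), -W, ?_⟩, rfl,
    isMinimal_of_eq_padIdentity hUV hS, ⟨U, V, 1, 1, isUnimodular_iff.2 hU, isUnimodular_iff.2 hV,
      by simp, by simp, ?_⟩,
    exists_isBiproper_mul_transferFunction_pencilRealization_mul S hdeg hαβ⟩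
  · rw [pencilRealization, Matrix.map_neg _ (map_neg Polynomial.C),
      Matrix.map_neg _ (map_neg Polynomial.C), smul_neg, sub_neg_eq_add, neg_add_eq_sub]
  · rwa [Matrix.map_one _ (map_zero _) (map_one _)]

theorem perm_range'_of_append_cons_zero_perm {σ₁ σ₂ ω₁ : List ℕ} {m : ℕ}
    (h : (σ₁ ++ 0 :: σ₂ ++ ω₁).Perm (List.range (m + 1))) :
    (σ₁.reverse ++ ω₁ ++ σ₂.reverse).Perm (List.range' 1 m) := by
  rw [List.range_eq_range', List.range'_succ] at h
  refine List.Perm.cons_inv (a := 0) (.trans ?_ h)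
  rw [List.perm_iff_count]
  intro a
  simp only [List.count_append, List.count_cons, List.count_reverse]
  omega

end GeneralizedFiedlerPencil

end RatMat

theorem theorem3p12 {n m r : ℕ} (hm : 1 ≤ m)
    (G : Matrix (Fin n) (Fin n) (RatFunc ℂ))
    (S : RatMat.Realization (Fin n) r)
    -- `P(λ) = A_0 + λ A_1 + ⋯ + λ ^ m A_m` with `A_m ≠ 0`
    (hdeg : ∀ a b, (S.P a b).natDegree ≤ m) (hlead : S.coeff m ≠ 0)
    -- `G(λ) = P(λ) + C (λ E - A)⁻¹ B`, a minimal realization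
    (hG : G = S.transferFunction) (hmin : S.IsMinimal)
    -- `(ω₀, ω₁)` is a permutation of `{0, …, m}` with `0 ∈ ω₀`
    (ω₀ ω₁ : List ℕ) (hω : (ω₀ ++ ω₁).Perm (List.range (m + 1))) (h0 : 0 ∈ ω₀)
    -- if the index `m` is used in `ω₀`, the inverse of the Fiedler matrix `-m` has to exist
    (hinv : m ∈ ω₀ → IsUnit (S.coeff m).det) :
    RatMat.IsRosenbrockStrongLinearization m G S (RatMat.gfp m S ω₀ ω₁) := by
  obtain ⟨M, rfl⟩ := Nat.exists_eq_add_of_le' hm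
  subst hG
  obtain ⟨σ₁, σ₂, rfl⟩ := List.append_of_mem h0
  have hτ := RatMat.perm_range'_of_append_cons_zero_perm hω
  have hfiedler (i : ℕ) (hi : i ∈ σ₁ ∨ i ∈ σ₂) :
      RatMat.fiedler (M + 1) S i * RatMat.fiedler (M + 1) S (-i) = 1 ∧
        RatMat.fiedler (M + 1) S i ∈ RatMat.invertibleBlockDiagonal _ _ ℂ := by
    obtain ⟨hi₁, hiM⟩ := RatMat.mem_bounds_of_perm_range' hτ (j := i) (by grind)
    have htop : i = M + 1 → IsUnit (S.coeff (M + 1)).det := fun h => hinv (by grind)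
    exact ⟨RatMat.fiedler_mul_fiedler_neg S hi₁ hiM htop,
      RatMat.fiedler_mem_invertibleBlockDiagonal S hi₁ hiM htop⟩
  have hprod (σ : List ℕ) (hσ : ∀ i ∈ σ, i ∈ σ₁ ∨ i ∈ σ₂) :
      (σ.map fun i : ℕ => RatMat.fiedler (M + 1) S i).prod ∈
        RatMat.invertibleBlockDiagonal _ _ ℂ :=
    Submonoid.list_prod_mem _ (List.forall_mem_map.2 fun i hi => (hfiedler i (hσ i hi)).2)
  rw [RatMat.gfp_append_cons_zero S ω₁ (fun i hi => (hfiedler i (.inl hi)).1)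
    fun i hi => (hfiedler i (.inr hi)).1]
  exact (RatMat.isRosenbrockStrongLinearization_gfp_singleton_zero S hdeg hmin hτ).mul_mul
    (hprod σ₁ fun _ => .inl) (hprod σ₂ fun _ => .inr)
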